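/- For integers $k\ge 0$ and $n\ge 1$ let $d_k(n)$ be the number of ordered ways of writing $n$ as a product of $k$ positive integers (so $d_0(1)=1$ and $d_0(n)=0$ for $n\ge 2$). For $l\ge 1$ and $A\in(0,1]$ let $$d_l(n,A)=\sum_{q\mid n,\ q\le n^A} d_{l-1}(q).$$ For $g\ge 1$ and $k\ge 0$, a real number $0<\theta\le 1$ is called an exponent of distribution for $d_k$ at $g$ if for every $\varepsilon>0$ there are $\delta>0$ and $C$ such that, for all real $x\ge 1$, all integers $1\le q\le x^{\theta-\varepsilon}$ and all residue classes $r\not\equiv 0 \pmod q$ with $\gcd(r,q)=g$, $$\Bigl|\sum_{\substack{n\le x\\ n\equiv r\,(q)}} d_k(n)-\frac{1}{\phi(q/g)}\sum_{\substack{n\le x/g\\ \gcd(n,\,q/g)=1}} d_k(gn)\Bigr|\le C\,\frac{x^{1-\delta}}{\phi(q/g)},$$ where $\phi$ is Euler's function. Let $h,k,l\ge 1$ be fixed integers, and let $\theta_k,\theta_{k-1},\theta_l$ be exponents of distribution for $d_k,d_{k-1},d_l$ respectively, at every $g\ge 1$. If $A,B>0$ are fixed real numbers with $A<\theta_l$ and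 $B<\min(\theta_k,\,A\theta_{k-1})$, then, as $x\to\infty$, $$\sum_{1\le n\le x} d_k(n+h,A)\bigl(d_l(n)-B^{1-l}d_l(n,B)\bigr)=O_{A,B,h,k,l}\bigl(x\log^{k+l-3}x\bigr).$$ -/

import Mathlib

namespace DivisorCorrelation

/-- `d_k(n)`: the number of ordered ways of writing `n` as a product of `k` positive integers.
In particular `d_0(1) = 1` and `d_0(n) = 0` for `n ≥ 2`. -/
def dk (k n : ℕ) : ℕ := (Nat.finMulAntidiag k n).card

/-- The partial divisor function `d_l(n, A)`, the sum of `d_{l-1}(q)` over the divisors `q` of `n`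
with `q ≤ n ^ A`. It is meant for `l ≥ 1` and `0 < A ≤ 1`. -/
noncomputable def partialDk (l n : ℕ) (A : ℝ) : ℕ :=
  ∑ q ∈ n.divisors.filter (fun q : ℕ => (q : ℝ) ≤ (n : ℝ) ^ A), dk (l - 1) q

/-- `∑ d_k(n)` over `1 ≤ n ≤ x` with `n ≡ r (mod q)`. -/
noncomputable def sumInClass (k q r : ℕ) (x : ℝ) : ℝ :=
  ∑ n ∈ Finset.Icc 1 ⌊x⌋₊ with n ≡ r [MOD q], (dk k n : ℝ)

/-- The expected value of `sumInClass k q r x` for a class `r` with `gcd(r, q) = g`: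
`φ(q/g)⁻¹ ∑_{n ≤ x/g} χ₀(n) d_k(g n)`, with `χ₀` the principal character modulo `q/g`. -/
noncomputable def expectedInClass (k q g : ℕ) (x : ℝ) : ℝ :=
  (1 / ((q / g).totient : ℝ)) *
    ∑ n ∈ Finset.Icc 1 ⌊x / g⌋₊ with n.Coprime (q / g), (dk k (g * n) : ℝ)

/-- `θ` is an exponent of distribution for `d_k` in the residue classes `r (mod q)` with
`gcd(r, q) = g`: for each `ε > 0` there is a power saving `δ > 0`, uniformly in all moduli
`q ≤ x ^ (θ - ε)` and all such classes other than the zero class. -/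
def IsExponentOfDistribution (g k : ℕ) (θ : ℝ) : Prop :=
  0 < θ ∧ θ ≤ 1 ∧
    ∀ ε : ℝ, 0 < ε → ∃ δ : ℝ, 0 < δ ∧ ∃ C : ℝ, ∀ x : ℝ, 1 ≤ x →
      ∀ q r : ℕ, 1 ≤ q → (q : ℝ) ≤ x ^ (θ - ε) → ¬ r ≡ 0 [MOD q] → Nat.gcd r q = g →
        |sumInClass k q r x - expectedInClass k q g x|
          ≤ C * (x ^ (1 - δ) / ((q / g).totient : ℝ))

end DivisorCorrelation

open Finset

namespace DivisorCorrelation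

/-! Normalise the partial divisor functions as `f t n = t^(1-k) d_k(n,t)` and `g t n = t^(1-l)
d_l(n,t)`. Over the multiples of `D` up to `N`, the main term of `g t` has order `N log^(l-1) N` and
does not depend on `t`, because the sum over divisors `d ≤ N^t` produces `(t log N)^(l-1)`. Hence a
difference `g t - g t'` loses a logarithm on average over multiples
(`exists_sum_partialDk_filter_dvd_asymp`, `smallOnMultiples_sub`).

Let `F` be such a difference and suppose its sums over residue classes mod `q ≤ x^α` depend, up to a
power saving, only on the gcd of the class with `q`. To sum `d_k(n+h,A) F(n)` with `A < α`, open the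
divisor function as a sum over `q ∣ n+h`, `q ≤ (n+h)^A`. The inner sum runs over the class of `-h`,
whose gcd with `q` divides `h`. It is close to its average over the classes of the same gcd, which
Möbius inversion reduces to sums over multiples of divisors of `q`
(`Equidistributed.abs_sumClass_le`). Summing `d_{k-1}(q)/q` with harmless weights costs `log^(k-1)`,
for a total of `log^(k+l-3)` (`exists_abs_sum_partialDk_mul_le`).

This does not apply directly to `f A (n+h) (g 1 n - g B n)`, since `g B` need not be equidistributed
beyond level `A`. With a small auxiliary `ε`, and `f` evaluated at `n+h`, `f A (g 1 - g B) = f A (g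
1 - g ε) + g ε (f A - f ε) + f ε (g ε - g B) - g B (f A - f ε)`, and in each product the factor
opened has an exponent below the level of the difference. The first term uses `θ_l > A`. The terms
with `f A - f ε` need `d_k(n,A)` to have a level above `B`: it is `d_k` minus the sum over `n = ab`
with `a > n^A`, where for fixed `b` the variable `a` reaches at least `x^A`, so that `d_{k-1}` has
level `A θ_{k-1}` in terms of `x` (`equidistributed_remainderDk`). The functions `g ε`, `g B` and `f
ε` are handled by trivial counting, available when level plus exponent is below 1
(`equidistributed_partialDk_of_add_lt_one`). -/

/-! ### Elementary properties of `dk` and the divisor bound. -/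

theorem dk_zero (n : ℕ) : dk 0 n = if n = 1 then 1 else 0 := by
  unfold dk
  split_ifs with h
  · subst h; rw [Nat.finMulAntidiag_one]; simp
  · rw [Nat.finMulAntidiag_zero_left h]; simp

theorem dk_apply_zero (k : ℕ) : dk k 0 = 0 := by
  simp [dk, Nat.finMulAntidiag_zero_right]

/-- Fix the first factor `b` of a factorisation: the tail is a factorisation of `n / b`. Then
reindex by `b ↦ n / b`. -/
theorem dk_succ (k n : ℕ) : dk (k + 1) n = ∑ a ∈ n.divisors, dk k a := by
  rcases eq_or_ne n 0 with rfl | hn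
  · simp [dk_apply_zero]
  rw [← Nat.sum_div_divisors n (fun a => dk k a)]
  unfold dk
  rw [Finset.card_eq_sum_card_fiberwise (f := fun f => f 0) (t := n.divisors)]
  · refine Finset.sum_congr rfl fun b hb => ?_
    have hb' := Nat.mem_divisors.1 hb
    have hb0 : b ≠ 0 := fun h => by simp [h] at hb'
    refine Finset.card_bij' (fun f _ => Fin.tail f) (fun f _ => Fin.cons b f) ?_ ?_ ?_ ?_
    · intro f hf
      simp only [mem_filter, Nat.mem_finMulAntidiag] at hf ⊢
      obtain ⟨⟨h1, _⟩, h2⟩ := hf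
      rw [Fin.prod_univ_succ, h2] at h1
      refine ⟨?_, ?_⟩
      · rw [← h1, Nat.mul_div_cancel_left _ (Nat.pos_of_ne_zero hb0)]; rfl
      · exact (Nat.div_pos (Nat.le_of_dvd (Nat.pos_of_ne_zero hn) hb'.1)
          (Nat.pos_of_ne_zero hb0)).ne'
    · intro f hf
      simp only [mem_filter, Nat.mem_finMulAntidiag] at hf ⊢
      refine ⟨⟨?_, hn⟩, by simp⟩
      rw [Fin.prod_univ_succ]
      simp [hf.1, Nat.mul_div_cancel' hb'.1]
    · intro f hf
      simp only [mem_filter] at hf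
      rw [← hf.2]
      exact Fin.cons_self_tail f
    · intro f hf
      simp
  · intro f hf
    simp only [mem_coe] at hf ⊢
    exact Nat.mem_divisors.2 ⟨Nat.dvd_of_mem_finMulAntidiag hf 0, hn⟩

theorem dk_one {n : ℕ} (hn : n ≠ 0) : dk 1 n = 1 := by
  rw [dk_succ]
  simp [dk_zero, hn]

theorem partialDk_one {l : ℕ} (hl : 1 ≤ l) (n : ℕ) : partialDk l n 1 = dk l n := by
  obtain ⟨l, rfl⟩ := Nat.exists_eq_add_of_le' hl
  rw [partialDk, dk_succ, Finset.filter_true_of_mem]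
  · simp
  · intro q hq
    simpa using Nat.divisor_le hq

theorem partialDk_one_left {n : ℕ} (hn : n ≠ 0) {A : ℝ} (hA : 0 ≤ A) : partialDk 1 n A = 1 := by
  have h1 : (1 : ℝ) ≤ n := by exact_mod_cast Nat.one_le_iff_ne_zero.2 hn
  simp [partialDk, dk_zero, hn, Real.one_le_rpow h1 hA]

/-- Each divisor `a` of `m * n` splits as `gcd(a,m)` times a divisor of `n`, and this is an
injection into pairs of divisors; the rest is induction through `dk_succ`. -/
theorem dk_mul_le (k m n : ℕ) : dk k (m * n) ≤ dk k m * dk k n := by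
  induction k generalizing m n with
  | zero =>
    simp only [dk_zero, mul_eq_one]
    split_ifs <;> simp_all
  | succ k ih =>
    rcases eq_or_ne m 0 with rfl | hm
    · simp [dk_apply_zero]
    rcases eq_or_ne n 0 with rfl | hn
    · simp [dk_apply_zero]
    rw [dk_succ, dk_succ, dk_succ, Finset.sum_mul_sum, ← Finset.sum_product']
    have key : ∀ a ∈ (m * n).divisors, a.gcd m * (a / a.gcd m) = a ∧ a / a.gcd m ∣ n := by
      intro a ha
      have hpos : 0 < a.gcd m := Nat.gcd_pos_of_pos_right _ (Nat.pos_of_ne_zero hm)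
      refine ⟨Nat.mul_div_cancel' (Nat.gcd_dvd_left _ _), ?_⟩
      refine (Nat.coprime_div_gcd_div_gcd hpos).dvd_of_dvd_mul_left ?_
      rw [← Nat.mul_div_right_comm (Nat.gcd_dvd_right _ _)]
      exact Nat.div_dvd_div (Nat.gcd_dvd_left _ _) (Nat.dvd_of_mem_divisors ha)
    calc ∑ a ∈ (m * n).divisors, dk k a
        ≤ ∑ a ∈ (m * n).divisors, dk k (a.gcd m) * dk k (a / a.gcd m) := by
          refine Finset.sum_le_sum fun a ha => ?_
          conv_lhs => rw [← (key a ha).1]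
          exact ih _ _
      _ = ∑ p ∈ (m * n).divisors.image (fun a => (a.gcd m, a / a.gcd m)), dk k p.1 * dk k p.2 := by
          rw [Finset.sum_image]
          intro a ha b hb hab
          rw [← (key a ha).1, ← (key b hb).1]
          simp only [Prod.mk.injEq] at hab
          rw [hab.2, hab.1]
      _ ≤ _ := by
          refine Finset.sum_le_sum_of_subset ?_
          intro p hp
          obtain ⟨a, ha, rfl⟩ := Finset.mem_image.1 hp
          exact Finset.mem_product.2 ⟨Nat.mem_divisors.2 ⟨Nat.gcd_dvd_right _ _, hm⟩,
            Nat.mem_divisors.2 ⟨(key a ha).2, hn⟩⟩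

/-- The divisor bound. -/
theorem exists_card_divisors_le_rpow {η : ℝ} (hη : 0 < η) :
    ∃ C : ℝ, 1 ≤ C ∧ ∀ n : ℕ, n ≠ 0 → (n.divisors.card : ℝ) ≤ C * (n : ℝ) ^ η := by
  -- For `p ≥ P` one has `p^η ≥ 2`, so `a + 1 ≤ 2^a ≤ p^(aη)` with no loss. Each of the at most `P`
  -- smaller primes costs a factor `K`.
  obtain ⟨P, hP⟩ := exists_nat_gt ((2 : ℝ) ^ (1 / η))
  set K : ℝ := 1 + 1 / (η * Real.log 2) with hK
  have hlog2 : 0 < Real.log 2 := Real.log_pos (by norm_num)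
  have hK1 : 1 ≤ K := by rw [hK]; have : 0 < 1 / (η * Real.log 2) := by positivity
                         linarith
  refine ⟨K ^ P, one_le_pow₀ hK1, fun n hn => ?_⟩
  have h1 : ∀ p ∈ n.primeFactors, ((n.factorization p + 1 : ℕ) : ℝ) ≤
      (if p < P then K else 1) * ((p : ℝ) ^ (n.factorization p)) ^ η := by
    intro p hp
    have hp2 : (2 : ℝ) ≤ p := by exact_mod_cast (Nat.prime_of_mem_primeFactors hp).two_le
    set a := n.factorization p
    have hpa : ((p : ℝ) ^ a) ^ η = ((p : ℝ) ^ η) ^ a := by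
      rw [← Real.rpow_natCast, ← Real.rpow_mul (by positivity), mul_comm, Real.rpow_mul (by positivity),
        Real.rpow_natCast]
    split_ifs with h
    · have h2 : 1 + (a : ℝ) * (η * Real.log 2) ≤ ((p : ℝ) ^ a) ^ η := by
        calc 1 + (a : ℝ) * (η * Real.log 2) ≤ Real.exp ((a : ℝ) * (η * Real.log 2)) := by
              linarith [Real.add_one_le_exp ((a : ℝ) * (η * Real.log 2))]
          _ = ((2 : ℝ) ^ η) ^ a := by
              rw [Real.rpow_def_of_pos (by norm_num), ← Real.exp_nat_mul]; ring_nf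
          _ ≤ ((p : ℝ) ^ η) ^ a := by gcongr
          _ = _ := hpa.symm
      calc ((a + 1 : ℕ) : ℝ) ≤ K * (1 + (a : ℝ) * (η * Real.log 2)) := by
            have : K * (1 + (a : ℝ) * (η * Real.log 2))
              = 1 + a + 1 / (η * Real.log 2) + a * (η * Real.log 2) := by
              rw [hK]; field_simp; ring
            rw [this]
            have : 0 ≤ 1 / (η * Real.log 2) + a * (η * Real.log 2) := by positivity
            push_cast; linarith
        _ ≤ _ := by gcongr
    · rw [one_mul, hpa]
      have hpP : (2 : ℝ) ^ (1 / η) ≤ p := hP.le.trans (by exact_mod_cast not_lt.1 h)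
      have : (2 : ℝ) ≤ (p : ℝ) ^ η := by
        calc (2 : ℝ) = ((2 : ℝ) ^ (1 / η)) ^ η := by
              rw [← Real.rpow_mul (by norm_num), one_div_mul_cancel hη.ne', Real.rpow_one]
          _ ≤ _ := by gcongr
      calc ((a + 1 : ℕ) : ℝ) ≤ (2 : ℝ) ^ a := by exact_mod_cast Nat.lt_two_pow_self
        _ ≤ _ := by gcongr
  rw [Nat.card_divisors hn]
  push_cast
  calc ∏ p ∈ n.primeFactors, ((n.factorization p : ℝ) + 1)
      ≤ ∏ p ∈ n.primeFactors, ((if p < P then K else 1) * ((p : ℝ) ^ (n.factorization p)) ^ η) := by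
        refine Finset.prod_le_prod (fun _ _ => by positivity) fun p hp => ?_
        exact_mod_cast h1 p hp
    _ = (∏ p ∈ n.primeFactors, (if p < P then K else 1)) * (n : ℝ) ^ η := by
        rw [Finset.prod_mul_distrib, Real.finsetProd_rpow _ _ (fun _ _ => by positivity)]
        congr 2
        have := Nat.prod_factorization_pow_eq_self hn
        conv_rhs => rw [← this]
        rw [Finsupp.prod]
        push_cast
        rfl
    _ ≤ _ := by
        gcongr
        rw [Finset.prod_ite, Finset.prod_const, Finset.prod_const_one, mul_one]
        refine pow_le_pow_right₀ hK1 ?_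
        calc _ ≤ (Finset.range P).card := Finset.card_le_card fun p hp => by
                simpa using (Finset.mem_filter.1 hp).2
          _ = P := by simp

theorem dk_le_card_divisors_pow (k : ℕ) {n : ℕ} (hn : n ≠ 0) : dk k n ≤ n.divisors.card ^ k := by
  induction k generalizing n with
  | zero => rw [dk_zero]; split_ifs <;> simp
  | succ k ih =>
    rw [dk_succ, pow_succ']
    refine (Finset.sum_le_card_nsmul _ _ (n.divisors.card ^ k) fun a ha => ?_).trans_eq (by simp)
    have ha' := Nat.dvd_of_mem_divisors ha
    refine (ih (ne_zero_of_dvd_ne_zero hn ha')).trans ?_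
    gcongr

theorem exists_dk_le_rpow (k : ℕ) {η : ℝ} (hη : 0 < η) :
    ∃ C : ℝ, 1 ≤ C ∧ ∀ n : ℕ, n ≠ 0 → (dk k n : ℝ) ≤ C * (n : ℝ) ^ η := by
  obtain ⟨C, hC, h⟩ := exists_card_divisors_le_rpow (η := η / (k + 1)) (by positivity)
  refine ⟨C ^ k, one_le_pow₀ hC, fun n hn => ?_⟩
  have h1 : (1 : ℝ) ≤ n := by exact_mod_cast Nat.one_le_iff_ne_zero.2 hn
  calc (dk k n : ℝ) ≤ (n.divisors.card : ℝ) ^ k := by exact_mod_cast dk_le_card_divisors_pow k hn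
    _ ≤ (C * (n : ℝ) ^ (η / (k + 1))) ^ k := by gcongr; exact h n hn
    _ = C ^ k * (n : ℝ) ^ (η / (k + 1) * k) := by
        rw [mul_pow, Real.rpow_mul_natCast (by positivity)]
    _ ≤ _ := by
        gcongr
        · rw [div_mul_eq_mul_div, div_le_iff₀ (by positivity)]; nlinarith

/-! ### Summation over divisors and multiples, and upper bounds for weighted sums of `dk`. -/

theorem sum_Icc_filter_dvd {M : Type*} [AddCommMonoid M] (N : ℕ) {e : ℕ} (he : 1 ≤ e)
    (f : ℕ → M) : ∑ n ∈ Icc 1 N with e ∣ n, f n = ∑ m ∈ Icc 1 (N / e), f (e * m) := by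
  have he' : 0 < e := he
  symm
  refine Finset.sum_bij (fun m _ => e * m) ?_ ?_ ?_ (fun _ _ => rfl)
  · intro m hm
    simp only [mem_Icc, mem_filter] at hm ⊢
    refine ⟨⟨Nat.mul_pos he' hm.1, ?_⟩, dvd_mul_right _ _⟩
    rw [mul_comm]; exact (Nat.le_div_iff_mul_le he').1 hm.2
  · intro a _ b _ hab
    exact Nat.eq_of_mul_eq_mul_left he' hab
  · intro n hn
    simp only [mem_Icc, mem_filter] at hn
    obtain ⟨⟨h1, h2⟩, m, rfl⟩ := hn
    refine ⟨m, ?_, rfl⟩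
    simp only [mem_Icc]
    refine ⟨Nat.pos_of_ne_zero (by rintro rfl; simp at h1), ?_⟩
    rw [Nat.le_div_iff_mul_le he', mul_comm]; exact h2

theorem sum_Icc_sum_divisors_filter {M : Type*} [AddCommMonoid M] (N : ℕ) (f : ℕ → ℕ → M) :
    ∑ n ∈ Icc 1 N, ∑ a ∈ n.divisors, f a n = ∑ a ∈ Icc 1 N, ∑ n ∈ Icc 1 N with a ∣ n, f a n := by
  refine Finset.sum_comm' fun n a => ?_
  simp only [mem_Icc, Nat.mem_divisors, mem_filter]
  constructor
  · rintro ⟨⟨h1, h2⟩, h3, h4⟩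
    exact ⟨⟨⟨h1, h2⟩, h3⟩, Nat.pos_of_dvd_of_pos h3 h1, (Nat.le_of_dvd h1 h3).trans h2⟩
  · rintro ⟨⟨⟨h1, h2⟩, h3⟩, h4, h5⟩
    exact ⟨⟨h1, h2⟩, h3, by omega⟩

theorem sum_Icc_sum_divisors {M : Type*} [AddCommMonoid M] (N : ℕ) (f : ℕ → ℕ → M) :
    ∑ n ∈ Icc 1 N, ∑ a ∈ n.divisors, f a n =
      ∑ a ∈ Icc 1 N, ∑ b ∈ Icc 1 (N / a), f a (a * b) := by
  rw [sum_Icc_sum_divisors_filter]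
  refine Finset.sum_congr rfl fun a ha => ?_
  exact sum_Icc_filter_dvd N (mem_Icc.1 ha).1 _

theorem Icc_one_floor_eq_empty {z : ℝ} (hz : z < 1) : Icc 1 ⌊z⌋₊ = ∅ := by
  rw [Nat.floor_eq_zero.2 hz]; rfl

theorem floor_div_natCast' (z : ℝ) (e : ℕ) : ⌊z / e⌋₊ = ⌊z⌋₊ / e := Nat.floor_div_natCast z e

theorem cast_mem_Icc_floor {z : ℝ} {a : ℕ} (ha : a ∈ Icc 1 ⌊z⌋₊) :
    1 ≤ (a : ℝ) ∧ (a : ℝ) ≤ z := by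
  obtain ⟨h1, h2⟩ := mem_Icc.1 ha
  exact ⟨by exact_mod_cast h1, (Nat.le_floor_iff' (by omega)).1 h2⟩

theorem sum_inv_le_one_add_log {z : ℝ} (hz : 1 ≤ z) :
    ∑ a ∈ Icc 1 ⌊z⌋₊, (1 : ℝ) / a ≤ 1 + Real.log z := by
  have := harmonic_floor_le_one_add_log z hz
  rw [harmonic_eq_sum_Icc] at this
  simpa using this

theorem sum_dk_div_le (i : ℕ) {z : ℝ} (hz : 1 ≤ z) :
    ∑ a ∈ Icc 1 ⌊z⌋₊, (dk i a : ℝ) / a ≤ (1 + Real.log z) ^ i := by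
  have hL : 0 ≤ Real.log z := Real.log_nonneg hz
  induction i with
  | zero =>
    simp only [dk_zero, pow_zero]
    rw [Finset.sum_eq_single 1]
    · simp
    · intro b _ hb; simp [hb]
    · intro h; simp at h; simp; linarith
  | succ i ih =>
    calc ∑ n ∈ Icc 1 ⌊z⌋₊, (dk (i + 1) n : ℝ) / n
        = ∑ n ∈ Icc 1 ⌊z⌋₊, ∑ a ∈ n.divisors, (dk i a : ℝ) / n := by
          refine Finset.sum_congr rfl fun n _ => ?_
          rw [dk_succ]; push_cast; rw [Finset.sum_div]
      _ = ∑ a ∈ Icc 1 ⌊z⌋₊, ∑ b ∈ Icc 1 (⌊z⌋₊ / a), (dk i a : ℝ) / (a * b : ℕ) :=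
          sum_Icc_sum_divisors _ (fun a n => (dk i a : ℝ) / n)
      _ ≤ ∑ a ∈ Icc 1 ⌊z⌋₊, (dk i a : ℝ) / a * (1 + Real.log z) := by
          refine Finset.sum_le_sum fun a ha => ?_
          calc _ = (dk i a : ℝ) / a * ∑ b ∈ Icc 1 (⌊z⌋₊ / a), (1 : ℝ) / b := by
                rw [Finset.mul_sum]
                refine Finset.sum_congr rfl fun b _ => ?_
                push_cast
                rw [div_mul_div_comm, mul_one]
            _ ≤ _ := by
                refine mul_le_mul_of_nonneg_left ?_ (by positivity)
                refine le_trans ?_ (sum_inv_le_one_add_log hz)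
                refine Finset.sum_le_sum_of_subset_of_nonneg ?_ (fun _ _ _ => by positivity)
                exact Finset.Icc_subset_Icc_right (Nat.div_le_self _ _)
      _ ≤ _ := by
          rw [← Finset.sum_mul, pow_succ]
          gcongr

theorem sum_dk_div_filter_dvd_le (i : ℕ) {z : ℝ} (hz : 1 ≤ z) {e : ℕ} (he : 1 ≤ e) :
    ∑ a ∈ Icc 1 ⌊z⌋₊ with e ∣ a, (dk i a : ℝ) / a ≤ (dk i e : ℝ) / e * (1 + Real.log z) ^ i := by
  rw [sum_Icc_filter_dvd _ he]
  refine le_trans ?_ (mul_le_mul_of_nonneg_left (sum_dk_div_le i hz) (by positivity))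
  rw [Finset.mul_sum]
  calc _ ≤ ∑ m ∈ Icc 1 (⌊z⌋₊ / e), (dk i e : ℝ) / e * ((dk i m : ℝ) / m) := by
        refine Finset.sum_le_sum fun m _ => ?_
        rw [div_mul_div_comm]
        push_cast
        gcongr
        exact_mod_cast dk_mul_le i e m
    _ ≤ _ := Finset.sum_le_sum_of_subset_of_nonneg
        (Finset.Icc_subset_Icc_right (Nat.div_le_self _ _)) (fun _ _ _ => by positivity)

theorem sum_rpow_sub_one_le {η : ℝ} (h0 : 0 < η) (h1 : η ≤ 1) {w : ℝ} (hw : 0 ≤ w) :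
    ∑ b ∈ Icc 1 ⌊w⌋₊, (b : ℝ) ^ (η - 1) ≤ w ^ η / η := by
  have key : ∀ N : ℕ, ∑ b ∈ Icc 1 N, (b : ℝ) ^ (η - 1) ≤ (N : ℝ) ^ η / η := by
    intro N
    induction N with
    | zero => simp [h0.ne']
    | succ N ih =>
      rw [Finset.sum_Icc_succ_top (by omega)]
      have hN : (0 : ℝ) < ((N + 1 : ℕ) : ℝ) := by positivity
      set M : ℝ := ((N + 1 : ℕ) : ℝ) with hM
      have hNM : (N : ℝ) = M * (1 + -(1 / M)) := by rw [hM]; push_cast; field_simp; ring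
      -- Bernoulli's inequality for exponents in `[0,1]`; it gives `M^η - (M-1)^η ≥ η M^(η-1)`,
      -- which is the induction step.
      have h3 : (1 + -(1 / M)) ^ η ≤ 1 + η * (-(1 / M)) := by
        refine rpow_one_add_le_one_add_mul_self ?_ h0.le h1
        have : 1 / M ≤ 1 := by
          rw [div_le_one hN, hM]; push_cast; linarith [Nat.cast_nonneg (α := ℝ) N]
        linarith
      have h4 : (N : ℝ) ^ η ≤ M ^ η * (1 + η * (-(1 / M))) := by
        rw [hNM, Real.mul_rpow hN.le]
        · gcongr
        · have : 1 / M ≤ 1 := by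
            rw [div_le_one hN, hM]; push_cast; linarith [Nat.cast_nonneg (α := ℝ) N]
          linarith
      have h5 : M ^ (η - 1) = M ^ η / M := by rw [Real.rpow_sub hN, Real.rpow_one]
      rw [h5]
      refine (add_le_add_left ih _).trans ?_
      rw [div_add' _ _ _ h0.ne']
      gcongr
      calc (N : ℝ) ^ η + M ^ η / M * η ≤ M ^ η * (1 + η * (-(1 / M))) + M ^ η / M * η := by gcongr
        _ = M ^ η := by field_simp; ring
  refine (key _).trans ?_
  gcongr
  exact Nat.floor_le hw

theorem sum_dk_mul_rpow_le (j : ℕ) {η : ℝ} (h0 : 0 < η) (h1 : η ≤ 1) {z : ℝ} (hz : 1 ≤ z) :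
    ∑ a ∈ Icc 1 ⌊z⌋₊, (dk (j + 1) a : ℝ) * (a : ℝ) ^ (η - 1) ≤
      z ^ η / η * (1 + Real.log z) ^ j := by
  calc ∑ n ∈ Icc 1 ⌊z⌋₊, (dk (j + 1) n : ℝ) * (n : ℝ) ^ (η - 1)
      = ∑ n ∈ Icc 1 ⌊z⌋₊, ∑ a ∈ n.divisors, (dk j a : ℝ) * (n : ℝ) ^ (η - 1) := by
        refine Finset.sum_congr rfl fun n _ => ?_
        rw [dk_succ]; push_cast; rw [Finset.sum_mul]
    _ = ∑ a ∈ Icc 1 ⌊z⌋₊, ∑ b ∈ Icc 1 (⌊z⌋₊ / a), (dk j a : ℝ) * ((a * b : ℕ) : ℝ) ^ (η - 1) :=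
        sum_Icc_sum_divisors _ (fun a n => (dk j a : ℝ) * (n : ℝ) ^ (η - 1))
    _ ≤ ∑ a ∈ Icc 1 ⌊z⌋₊, z ^ η / η * ((dk j a : ℝ) / a) := by
        refine Finset.sum_le_sum fun a ha => ?_
        obtain ⟨ha1, ha2⟩ := cast_mem_Icc_floor ha
        have ha0 : (0 : ℝ) < a := by linarith
        calc _ = (dk j a : ℝ) * (a : ℝ) ^ (η - 1) * ∑ b ∈ Icc 1 ⌊z / a⌋₊, (b : ℝ) ^ (η - 1) := by
              rw [Finset.mul_sum, floor_div_natCast']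
              refine Finset.sum_congr rfl fun b _ => ?_
              push_cast
              rw [Real.mul_rpow (by positivity) (by positivity), mul_assoc]
          _ ≤ (dk j a : ℝ) * (a : ℝ) ^ (η - 1) * ((z / a) ^ η / η) := by
              gcongr
              exact sum_rpow_sub_one_le h0 h1 (by positivity)
          _ = _ := by
              rw [Real.rpow_sub ha0, Real.rpow_one, Real.div_rpow (by linarith) ha0.le]
              have : (a : ℝ) ^ η ≠ 0 := by positivity
              field_simp
    _ ≤ _ := by
        rw [← Finset.mul_sum]
        have : (0:ℝ) ≤ z := by linarith
        gcongr
        exact sum_dk_div_le j hz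

theorem gcd_eq_sum_totient (d D : ℕ) (hD : D ≠ 0) :
    ((d.gcd D : ℕ) : ℝ) = ∑ e ∈ D.divisors with e ∣ d, (e.totient : ℝ) := by
  rw [← Nat.sum_totient (d.gcd D)]
  push_cast
  refine Finset.sum_congr ?_ fun _ _ => rfl
  ext e
  simp only [Nat.mem_divisors, mem_filter, Nat.dvd_gcd_iff, ne_eq, Nat.gcd_eq_zero_iff]
  tauto

/-- Gauss's identity `∑_{e ∣ m} φ(e) = m` at `m = gcd(d, D)` trades a gcd weight for divisibility
conditions. Such weights arise from `1 / lcm(d, D) = gcd(d, D) / (d D)`. -/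
theorem sum_mul_gcd (s : Finset ℕ) (D : ℕ) (hD : D ≠ 0) (f : ℕ → ℝ) :
    ∑ d ∈ s, f d * ((d.gcd D : ℕ) : ℝ) =
      ∑ e ∈ D.divisors, (e.totient : ℝ) * ∑ d ∈ s with e ∣ d, f d := by
  simp_rw [gcd_eq_sum_totient _ D hD, Finset.mul_sum, Finset.sum_filter]
  rw [Finset.sum_comm]
  refine Finset.sum_congr rfl fun e _ => Finset.sum_congr rfl fun d _ => ?_
  split_ifs <;> ring

/-- After opening the gcd, writing `d = e m` leaves `φ(e) e^(η-1) (z/e)^η ≤ z^η`, so each `e ∣ D`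
contributes a factor `dk (j+1) e`, and these add up to `dk (j+2) D`. -/
theorem sum_dk_mul_gcd_mul_rpow_le (j : ℕ) {η : ℝ} (h0 : 0 < η) (h1 : η ≤ 1) {z : ℝ} (hz : 1 ≤ z)
    {D : ℕ} (hD : D ≠ 0) :
    ∑ d ∈ Icc 1 ⌊z⌋₊, (dk (j + 1) d : ℝ) * (d : ℝ) ^ (η - 1) * ((d.gcd D : ℕ) : ℝ) ≤
      (dk (j + 2) D : ℝ) * (z ^ η / η * (1 + Real.log z) ^ j) := by
  have hL : 0 ≤ Real.log z := Real.log_nonneg hz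
  rw [sum_mul_gcd _ D hD, dk_succ]
  push_cast
  rw [Finset.sum_mul]
  refine Finset.sum_le_sum fun e he => ?_
  have he1 : 1 ≤ e := Nat.pos_of_mem_divisors he
  have he0 : (0 : ℝ) < e := by exact_mod_cast he1
  rw [sum_Icc_filter_dvd _ he1, ← floor_div_natCast']
  have hz0 : (0 : ℝ) ≤ z := by linarith
  rcases lt_or_ge (z / e) 1 with h | h
  · rw [Icc_one_floor_eq_empty h]
    simp only [Finset.sum_empty, mul_zero]
    positivity
  calc _ ≤ (e : ℝ) * ∑ m ∈ Icc 1 ⌊z / e⌋₊,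
        (dk (j + 1) e : ℝ) * (e : ℝ) ^ (η - 1) * ((dk (j + 1) m : ℝ) * (m : ℝ) ^ (η - 1)) := by
        refine mul_le_mul (by exact_mod_cast Nat.totient_le e) (Finset.sum_le_sum fun m _ => ?_)
          (Finset.sum_nonneg fun _ _ => by positivity) (by positivity)
        · push_cast
          rw [Real.mul_rpow (by positivity) (by positivity)]
          have : (dk (j + 1) (e * m) : ℝ) ≤ dk (j + 1) e * dk (j + 1) m := by
            exact_mod_cast dk_mul_le _ _ _
          calc _ ≤ (dk (j + 1) e * dk (j + 1) m : ℝ) * ((e : ℝ) ^ (η - 1) * (m : ℝ) ^ (η - 1)) := by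
                gcongr
            _ = _ := by ring
    _ ≤ (e : ℝ) * ((dk (j + 1) e : ℝ) * (e : ℝ) ^ (η - 1) *
        ((z / e) ^ η / η * (1 + Real.log z) ^ j)) := by
        rw [← Finset.mul_sum]
        gcongr
        refine (sum_dk_mul_rpow_le j h0 h1 h).trans ?_
        have h2 : 0 ≤ Real.log (z / e) := Real.log_nonneg h
        gcongr
        exact div_le_self hz0 (by exact_mod_cast he1)
    _ = _ := by
        rw [Real.rpow_sub he0, Real.rpow_one, Real.div_rpow hz0 he0.le]
        have : (e : ℝ) ^ η ≠ 0 := by positivity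
        field_simp

/-! ### Asymptotics of logarithmic sums of `dk` over multiples. -/

theorem pow_succ_sub_pow_succ_bounds {s u : ℝ} (hs : 0 ≤ s) (hsu : s ≤ u) (i : ℕ) :
    (i + 1) * s ^ i * (u - s) ≤ u ^ (i + 1) - s ^ (i + 1) ∧
      u ^ (i + 1) - s ^ (i + 1) ≤ (i + 1) * u ^ i * (u - s) := by
  have hu : 0 ≤ u := hs.trans hsu
  induction i with
  | zero => simp
  | succ i ih =>
    have h1 : u ^ (i + 1 + 1) - s ^ (i + 1 + 1) =
        u * (u ^ (i + 1) - s ^ (i + 1)) + s ^ (i + 1) * (u - s) := by ring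
    have h2 : s ^ (i + 1) ≤ u ^ (i + 1) := by gcongr
    have h3 : 0 ≤ u - s := by linarith
    rw [h1]
    push_cast
    constructor
    · calc ((i : ℝ) + 1 + 1) * s ^ (i + 1) * (u - s)
          = s * ((i + 1) * s ^ i * (u - s)) + s ^ (i + 1) * (u - s) := by ring
        _ ≤ u * (u ^ (i + 1) - s ^ (i + 1)) + s ^ (i + 1) * (u - s) := by
          gcongr
          exact ih.1
    · calc u * (u ^ (i + 1) - s ^ (i + 1)) + s ^ (i + 1) * (u - s)
          ≤ u * ((i + 1) * u ^ i * (u - s)) + u ^ (i + 1) * (u - s) := by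
            gcongr
            exact ih.2
        _ = _ := by ring

theorem log_div_succ_bounds {v : ℝ} (hv : 0 < v) {N : ℕ} (hN : 1 ≤ N) :
    1 / ((N : ℝ) + 1) ≤ Real.log (v / N) - Real.log (v / (N + 1)) ∧
      Real.log (v / N) - Real.log (v / (N + 1)) ≤ 1 / N := by
  have hN0 : (0 : ℝ) < N := by exact_mod_cast hN
  have h1 : Real.log (v / N) - Real.log (v / (N + 1)) = Real.log (1 + 1 / N) := by
    rw [← Real.log_div (by positivity) (by positivity)]
    congr 1
    field_simp
  rw [h1]
  constructor
  · have := Real.one_sub_inv_le_log_of_pos (x := 1 + 1 / (N : ℝ)) (by positivity)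
    refine le_trans (le_of_eq ?_) this
    field_simp
    ring
  · have := Real.log_le_sub_one_of_pos (x := 1 + 1 / (N : ℝ)) (by positivity)
    linarith

/-- Comparison with `∫ log(v/t)^i dt/t`, done discretely: each summand is compared with an increment
of `-log(v/t)^(i+1)/(i+1)`, and the increments telescope. -/
theorem sum_log_pow_div_bounds (i : ℕ) {v : ℝ} (hv : 1 ≤ v) :
    Real.log v ^ (i + 1) / (i + 1) ≤ ∑ m ∈ Icc 1 ⌊v⌋₊, Real.log (v / m) ^ i / m ∧
    ∑ m ∈ Icc 1 ⌊v⌋₊, Real.log (v / m) ^ i / m ≤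
      Real.log v ^ (i + 1) / (i + 1) + Real.log v ^ i := by
  have hv0 : 0 < v := by linarith
  have hi : (0 : ℝ) < (i : ℝ) + 1 := by positivity
  have upper : ∀ N : ℕ, 1 ≤ N → (N : ℝ) ≤ v → ∑ m ∈ Icc 1 N, Real.log (v / m) ^ i / m ≤
      Real.log v ^ i + (Real.log v ^ (i + 1) - Real.log (v / N) ^ (i + 1)) / (i + 1) := by
    intro N hN
    induction N, hN using Nat.le_induction with
    | base => intro _; simp
    | succ N hN ih =>
      intro hNv
      push_cast at hNv
      have hN0 : (0 : ℝ) < N := by exact_mod_cast hN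
      rw [Finset.sum_Icc_succ_top (by omega)]
      have hb := log_div_succ_bounds hv0 hN
      set u := Real.log (v / N)
      push_cast
      set s := Real.log (v / (N + 1))
      have hs : 0 ≤ s := Real.log_nonneg (by rw [le_div_iff₀ (by positivity)]; linarith)
      have hsu : s ≤ u := by
        have : (0:ℝ) < 1 / ((N : ℝ) + 1) := by positivity
        linarith
      have hp := (pow_succ_sub_pow_succ_bounds hs hsu i).1
      have h3 : s ^ i / ((N : ℝ) + 1) ≤ (u ^ (i + 1) - s ^ (i + 1)) / (i + 1) := by
        rw [le_div_iff₀ hi]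
        calc s ^ i / ((N : ℝ) + 1) * (i + 1) = (i + 1) * s ^ i * (1 / ((N : ℝ) + 1)) := by ring
          _ ≤ (i + 1) * s ^ i * (u - s) := by gcongr; exact hb.1
          _ ≤ _ := hp
      have h4 := ih (by linarith)
      have h5 : (Real.log v ^ (i + 1) - s ^ (i + 1)) / ((i : ℝ) + 1) =
        (Real.log v ^ (i + 1) - u ^ (i + 1)) / (i + 1) + (u ^ (i + 1) - s ^ (i + 1)) / (i + 1) := by
        ring
      linarith
  -- The truncation at 0 matters at `N = ⌊v⌋`, where `v / (N + 1) < 1` makes the logarithm negative;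
  -- there the subtracted term vanishes.
  have lower : ∀ N : ℕ, (N : ℝ) ≤ v → (Real.log v ^ (i + 1) -
      (max 0 (Real.log (v / (N + 1)))) ^ (i + 1)) / (i + 1) ≤
        ∑ m ∈ Icc 1 N, Real.log (v / m) ^ i / m := by
    intro N
    induction N with
    | zero =>
      intro _
      simp [Real.log_nonneg hv]
    | succ N ih =>
      intro hNv
      push_cast at hNv
      have h4 := ih (by linarith)
      rw [Finset.sum_Icc_succ_top (by omega)]
      have hb := (log_div_succ_bounds hv0 (N := N + 1) (by omega)).2
      push_cast at hb ⊢
      set u := Real.log (v / (N + 1))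
      set s' := Real.log (v / (N + 1 + 1))
      have hu : 0 ≤ u := Real.log_nonneg (by rw [le_div_iff₀ (by positivity)]; linarith)
      rw [max_eq_right hu] at h4
      have hs'u : s' ≤ u := by
        refine Real.log_le_log (by positivity) ?_
        gcongr
        linarith
      set s := max 0 s'
      have hs : 0 ≤ s := le_max_left _ _
      have hsu : s ≤ u := max_le hu hs'u
      have hus : u - s ≤ 1 / ((N : ℝ) + 1) := by
        have : s' ≤ s := le_max_right _ _
        linarith
      have hp := (pow_succ_sub_pow_succ_bounds hs hsu i).2
      have h3 : (u ^ (i + 1) - s ^ (i + 1)) / (i + 1) ≤ u ^ i / ((N : ℝ) + 1) := by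
        rw [div_le_iff₀ hi]
        calc _ ≤ (i + 1) * u ^ i * (u - s) := hp
          _ ≤ (i + 1) * u ^ i * (1 / ((N : ℝ) + 1)) := by gcongr
          _ = _ := by ring
      have h5 : (Real.log v ^ (i + 1) - s ^ (i + 1)) / ((i : ℝ) + 1) =
        (Real.log v ^ (i + 1) - u ^ (i + 1)) / (i + 1) + (u ^ (i + 1) - s ^ (i + 1)) / (i + 1) := by
        ring
      linarith
  have hf1 : 1 ≤ ⌊v⌋₊ := (Nat.one_le_floor_iff v).2 hv
  have hf2 : (⌊v⌋₊ : ℝ) ≤ v := Nat.floor_le hv0.le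
  constructor
  · have := lower _ hf2
    rw [max_eq_left] at this
    · simpa using this
    · refine Real.log_nonpos (by positivity) ?_
      rw [div_le_one (by positivity)]
      exact (Nat.lt_floor_add_one v).le
  · refine (upper _ hf1 hf2).trans ?_
    have h0 : 0 ≤ Real.log (v / ⌊v⌋₊) := by
      refine Real.log_nonneg ?_
      rw [le_div_iff₀ (by exact_mod_cast hf1)]; linarith
    have h1 : (Real.log v ^ (i + 1) - Real.log (v / ⌊v⌋₊) ^ (i + 1)) / ((i : ℝ) + 1) ≤
        Real.log v ^ (i + 1) / (i + 1) := by
      gcongr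
      have : 0 ≤ Real.log (v / ⌊v⌋₊) ^ (i + 1) := by positivity
      linarith
    linarith

/-- Substituting `b = e m` gives the previous sum at `w / e`; replacing `log(w/e)` by `log w` costs
a factor `log e` and one power of `log w`. When `w < e` the sum is empty and `log w ≤ log e` makes
the main term itself admissible as error. -/
theorem abs_sum_log_pow_div_filter_dvd_sub_le (i : ℕ) {w : ℝ} (hw : 1 ≤ w) {e : ℕ} (he : 1 ≤ e) :
    |∑ b ∈ Icc 1 ⌊w⌋₊ with e ∣ b, Real.log (w / b) ^ i / b
      - 1 / e * (Real.log w ^ (i + 1) / (i + 1))| ≤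
      1 / e * ((1 + Real.log e) * (1 + Real.log w) ^ i) := by
  have he0 : (0 : ℝ) < e := by exact_mod_cast he
  have he1 : (1 : ℝ) ≤ e := by exact_mod_cast he
  have hle : 0 ≤ Real.log e := Real.log_nonneg he1
  have hlw : 0 ≤ Real.log w := Real.log_nonneg hw
  have hi : (0 : ℝ) < (i : ℝ) + 1 := by positivity
  rw [sum_Icc_filter_dvd _ he, ← floor_div_natCast']
  have h1 : ∑ m ∈ Icc 1 ⌊w / e⌋₊, Real.log (w / (e * m : ℕ)) ^ i / (e * m : ℕ) =
      1 / e * ∑ m ∈ Icc 1 ⌊w / e⌋₊, Real.log (w / e / m) ^ i / m := by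
    rw [Finset.mul_sum]
    refine Finset.sum_congr rfl fun m _ => ?_
    push_cast
    rw [div_div, div_mul_div_comm, one_mul]
  rw [h1, ← mul_sub, abs_mul, abs_of_nonneg (by positivity : (0 : ℝ) ≤ 1 / e)]
  refine mul_le_mul_of_nonneg_left ?_ (by positivity)
  have hpow : Real.log w ^ i ≤ (1 + Real.log w) ^ i := by gcongr; linarith
  have h2 : 0 ≤ Real.log e * (1 + Real.log w) ^ i := by positivity
  rcases lt_or_ge (w / e) 1 with h | h
  · rw [Icc_one_floor_eq_empty h, Finset.sum_empty, zero_sub, abs_neg,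
      abs_of_nonneg (by positivity), div_le_iff₀ hi]
    have h3 : Real.log w ≤ Real.log e := by
      refine Real.log_le_log (by linarith) ?_
      rw [div_lt_one he0] at h; exact h.le
    have h5 : 0 ≤ (1 + Real.log w) ^ i := by positivity
    calc Real.log w ^ (i + 1) = Real.log w * Real.log w ^ i := by ring
      _ ≤ Real.log e * (1 + Real.log w) ^ i := by gcongr
      _ ≤ (1 + Real.log e) * (1 + Real.log w) ^ i * 1 := by nlinarith
      _ ≤ _ := by
        gcongr
        linarith [Nat.cast_nonneg (α := ℝ) i]
  · have hb := sum_log_pow_div_bounds i h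
    have hl : Real.log (w / e) = Real.log w - Real.log e :=
      Real.log_div (by linarith) he0.ne'
    have hl0 : 0 ≤ Real.log (w / e) := Real.log_nonneg h
    set ℓ := Real.log (w / e)
    have hlle : ℓ ≤ Real.log w := by linarith
    have hp := pow_succ_sub_pow_succ_bounds hl0 hlle i
    have h3 : Real.log w ^ (i + 1) / (i + 1) - ℓ ^ (i + 1) / (i + 1) ≤
        Real.log w ^ i * Real.log e := by
      rw [← sub_div, div_le_iff₀ hi]
      refine hp.2.trans (le_of_eq ?_)
      rw [hl]; ring
    have h4 : ℓ ^ (i + 1) / ((i : ℝ) + 1) ≤ Real.log w ^ (i + 1) / (i + 1) := by gcongr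
    have h5 : ℓ ^ i ≤ (1 + Real.log w) ^ i := by gcongr; linarith
    have h6 : Real.log w ^ i * Real.log e ≤ (1 + Real.log w) ^ i * Real.log e := by gcongr
    have h7 : 0 ≤ (1 + Real.log w) ^ i := by positivity
    rw [abs_le]
    constructor <;> nlinarith [hb.1, hb.2]

theorem dvd_mul_iff_div_gcd_dvd {e a b : ℕ} (he : 1 ≤ e) : e ∣ a * b ↔ e / a.gcd e ∣ b := by
  have hg : 0 < a.gcd e := Nat.gcd_pos_of_pos_right _ he
  constructor
  · intro h
    refine (Nat.coprime_div_gcd_div_gcd hg).symm.dvd_of_dvd_mul_left ?_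
    rw [← Nat.mul_div_right_comm (Nat.gcd_dvd_left _ _)]
    exact Nat.div_dvd_div (Nat.gcd_dvd_right _ _) h
  · intro h
    calc e = a.gcd e * (e / a.gcd e) := (Nat.mul_div_cancel' (Nat.gcd_dvd_right _ _)).symm
      _ ∣ a * b := mul_dvd_mul (Nat.gcd_dvd_left _ _) h

theorem exists_one_add_log_le_rpow {η : ℝ} (hη : 0 < η) :
    ∃ C : ℝ, 1 ≤ C ∧ ∀ x : ℝ, 1 ≤ x → 1 + Real.log x ≤ C * x ^ η := by
  refine ⟨1 + 1 / η, by have : 0 < 1 / η := by positivity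
                        linarith, fun x hx => ?_⟩
  have h1 := Real.log_le_rpow_div (x := x) (by linarith) hη
  have h2 := Real.one_le_rpow hx hη.le
  calc 1 + Real.log x ≤ x ^ η + x ^ η / η := by linarith
    _ = _ := by ring

/-- Induction on `j` with `i` free: writing `d = a b` and summing over `b` first turns `log^i` into
`log^(i+1)/(i+1)` and leaves `dk j a`. The saved logarithm appears as the factor `1 + log z` on the
left, which avoids the exponent `i + j - 1` when `i + j = 0`. -/
theorem exists_sum_dk_mul_log_pow_asymp (j : ℕ) : ∀ i : ℕ, ∃ c : ℕ → ℝ, ∀ η : ℝ, 0 < η →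
    ∃ C : ℝ, 0 ≤ C ∧ ∀ e : ℕ, 1 ≤ e → ∀ z : ℝ, 1 ≤ z →
      |∑ d ∈ Icc 1 ⌊z⌋₊ with e ∣ d, (dk j d : ℝ) / d * Real.log (z / d) ^ i
        - c e * Real.log z ^ (i + j)| * (1 + Real.log z) ≤
        C * (e : ℝ) ^ (η - 1) * (1 + Real.log z) ^ (i + j) := by
  induction j with
  | zero =>
    refine fun i => ⟨fun e => if e = 1 then 1 else 0, fun η _ => ⟨0, le_rfl, fun e he z hz => ?_⟩⟩
    have : ∑ d ∈ Icc 1 ⌊z⌋₊ with e ∣ d, (dk 0 d : ℝ) / d * Real.log (z / d) ^ i =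
        (if e = 1 then 1 else 0) * Real.log z ^ (i + 0) := by
      rw [Finset.sum_filter, Finset.sum_eq_single 1]
      · simp [dk_zero]
      · intro b _ hb; simp [dk_zero, hb]
      · intro h
        rw [mem_Icc] at h
        exact absurd ⟨le_rfl, (Nat.one_le_floor_iff z).2 hz⟩ h
    rw [this]; simp
  | succ j ih =>
    intro i
    obtain ⟨c, hc⟩ := ih (i + 1)
    -- For fixed `a`, the condition `e ∣ a b` restricts `b` to multiples of `e / gcd(a,e)`, giving
    -- the density `gcd(a,e)/e`. Opening the gcd by totients yields this recursion for the constant.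
    refine ⟨fun e => 1 / (e * (i + 1)) * ∑ f ∈ e.divisors, (f.totient : ℝ) * c f, fun η hη => ?_⟩
    have hη3 : 0 < η / 3 := by positivity
    obtain ⟨C₁, hC₁, h₁⟩ := hc (η / 3) hη3
    obtain ⟨C₂, hC₂, h₂⟩ := exists_dk_le_rpow (j + 1) hη3
    obtain ⟨C₃, hC₃, h₃⟩ := exists_one_add_log_le_rpow hη3
    obtain ⟨C₄, hC₄, h₄⟩ := exists_card_divisors_le_rpow hη3
    refine ⟨C₃ * C₂ + C₄ * C₁, by positivity, fun e he z hz => ?_⟩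
    have he0 : (0 : ℝ) < e := by exact_mod_cast he
    have he1 : (1 : ℝ) ≤ e := by exact_mod_cast he
    have hle : 0 ≤ Real.log e := Real.log_nonneg he1
    set L := Real.log z with hL
    have hL0 : 0 ≤ L := Real.log_nonneg hz
    have hi : (0 : ℝ) < (i : ℝ) + 1 := by positivity
    set g : ℕ → ℝ := fun a => ((a.gcd e : ℕ) : ℝ) with hg
    have step1 : ∑ d ∈ Icc 1 ⌊z⌋₊ with e ∣ d, (dk (j + 1) d : ℝ) / d * Real.log (z / d) ^ i =
        ∑ a ∈ Icc 1 ⌊z⌋₊, (dk j a : ℝ) / a * ∑ b ∈ Icc 1 ⌊z / a⌋₊ with e / a.gcd e ∣ b,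
          Real.log (z / a / b) ^ i / b := by
      rw [Finset.sum_filter]
      calc _ = ∑ n ∈ Icc 1 ⌊z⌋₊, ∑ a ∈ n.divisors,
            if e ∣ n then (dk j a : ℝ) / n * Real.log (z / n) ^ i else 0 := by
            refine Finset.sum_congr rfl fun n _ => ?_
            split_ifs
            · rw [dk_succ]; push_cast; rw [Finset.sum_div, Finset.sum_mul]
            · simp
        _ = _ := by
            rw [sum_Icc_sum_divisors _
              (fun a n => if e ∣ n then (dk j a : ℝ) / n * Real.log (z / n) ^ i else 0)]
            refine Finset.sum_congr rfl fun a _ => ?_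
            rw [floor_div_natCast', Finset.sum_filter, Finset.mul_sum]
            refine Finset.sum_congr rfl fun b _ => ?_
            simp only [dvd_mul_iff_div_gcd_dvd he, mul_ite, mul_zero]
            split_ifs
            · push_cast
              rw [div_div z, ← div_div (dk j a : ℝ)]
              ring
            · rfl
    have step2 : |∑ d ∈ Icc 1 ⌊z⌋₊ with e ∣ d, (dk (j + 1) d : ℝ) / d * Real.log (z / d) ^ i
        - 1 / (e * (i + 1)) * ∑ a ∈ Icc 1 ⌊z⌋₊, (dk j a : ℝ) / a * Real.log (z / a) ^ (i + 1) * g a|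
        ≤ 1 / e * ((1 + Real.log e) * (1 + L) ^ i) * ∑ a ∈ Icc 1 ⌊z⌋₊, (dk j a : ℝ) / a * g a := by
      rw [step1, Finset.mul_sum, Finset.mul_sum, ← Finset.sum_sub_distrib]
      refine (Finset.abs_sum_le_sum_abs _ _).trans (Finset.sum_le_sum fun a ha => ?_)
      obtain ⟨ha1, ha2⟩ := cast_mem_Icc_floor ha
      have ha0 : (0 : ℝ) < a := by linarith
      have hga : 0 < a.gcd e := Nat.gcd_pos_of_pos_right _ he
      have hg0 : 0 < g a := Nat.cast_pos.2 hga
      have hdiv : 1 ≤ e / a.gcd e := Nat.div_pos (Nat.le_of_dvd he (Nat.gcd_dvd_right _ _)) hga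
      have hcast : ((e / a.gcd e : ℕ) : ℝ) = e / g a :=
        Nat.cast_div (Nat.gcd_dvd_right _ _) hg0.ne'
      have hza : 1 ≤ z / a := by rw [le_div_iff₀ ha0]; linarith
      have hb := abs_sum_log_pow_div_filter_dvd_sub_le i hza hdiv
      rw [hcast] at hb
      have hlog1 : Real.log (e / g a) ≤ Real.log e := by
        refine Real.log_le_log (by positivity) (div_le_self he0.le ?_)
        exact Nat.one_le_cast.2 hga
      have hlog2 : Real.log (z / a) ≤ L :=
        Real.log_le_log (by linarith) (div_le_self (by linarith) ha1)
      have hlog3 : 0 ≤ Real.log (z / a) := Real.log_nonneg hza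
      have hlog4 : 0 ≤ Real.log (e / g a) := by
        rw [← hcast]; exact Real.log_nonneg (by exact_mod_cast hdiv)
      have heq : ∀ X : ℝ, (dk j a : ℝ) / a * X - 1 / (e * (i + 1)) *
          ((dk j a : ℝ) / a * Real.log (z / a) ^ (i + 1) * g a) =
          (dk j a : ℝ) / a * (X - 1 / (e / g a) * (Real.log (z / a) ^ (i + 1) / (i + 1))) := by
        intro X; field_simp
      rw [heq, abs_mul, abs_of_nonneg (by positivity)]
      calc _ ≤ (dk j a : ℝ) / a * (1 / (e / g a) * ((1 + Real.log (e / g a)) *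
            (1 + Real.log (z / a)) ^ i)) := by gcongr
        _ ≤ (dk j a : ℝ) / a * (1 / (e / g a) * ((1 + Real.log e) * (1 + L) ^ i)) := by gcongr
        _ = _ := by field_simp
    have step3 : ∑ a ∈ Icc 1 ⌊z⌋₊, (dk j a : ℝ) / a * g a ≤ (dk (j + 1) e : ℝ) * (1 + L) ^ j := by
      rw [sum_mul_gcd _ e (by omega), dk_succ]
      push_cast
      rw [Finset.sum_mul]
      refine Finset.sum_le_sum fun f hf => ?_
      have hf1 : 1 ≤ f := Nat.pos_of_mem_divisors hf
      have hf0 : (0 : ℝ) < f := by exact_mod_cast hf1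
      calc _ ≤ (f : ℝ) * ((dk j f : ℝ) / f * (1 + L) ^ j) := by
            refine mul_le_mul (by exact_mod_cast Nat.totient_le f)
              (sum_dk_div_filter_dvd_le j hz hf1) (Finset.sum_nonneg fun _ _ => by positivity)
              (by positivity)
        _ = _ := by field_simp
    have step4 : |∑ a ∈ Icc 1 ⌊z⌋₊, (dk j a : ℝ) / a * Real.log (z / a) ^ (i + 1) * g a
        - (∑ f ∈ e.divisors, (f.totient : ℝ) * c f) * L ^ (i + 1 + j)| * (1 + L) ≤
        C₄ * C₁ * (e : ℝ) ^ (η / 3 + η / 3) * (1 + L) ^ (i + 1 + j) := by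
      rw [sum_mul_gcd _ e (by omega), Finset.sum_mul, ← Finset.sum_sub_distrib]
      calc _ ≤ (∑ f ∈ e.divisors, C₁ * (e : ℝ) ^ (η / 3) * (1 + L) ^ (i + 1 + j) / (1 + L))
            * (1 + L) := by
            gcongr
            refine (Finset.abs_sum_le_sum_abs _ _).trans (Finset.sum_le_sum fun f hf => ?_)
            have hf1 : 1 ≤ f := Nat.pos_of_mem_divisors hf
            have hf0 : (0 : ℝ) < f := by exact_mod_cast hf1
            rw [mul_assoc, ← mul_sub, abs_mul, abs_of_nonneg (by positivity),
              le_div_iff₀ (by positivity)]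
            calc _ ≤ (f : ℝ) * (C₁ * (f : ℝ) ^ (η / 3 - 1) * (1 + L) ^ (i + 1 + j)) := by
                  rw [mul_assoc]
                  refine mul_le_mul (by exact_mod_cast Nat.totient_le f) (h₁ f hf1 z hz)
                    (by positivity) (by positivity)
              _ = C₁ * (f : ℝ) ^ (η / 3) * (1 + L) ^ (i + 1 + j) := by
                  rw [Real.rpow_sub hf0, Real.rpow_one]; field_simp
              _ ≤ _ := by
                  gcongr
                  exact Nat.divisor_le hf
        _ = (e.divisors.card : ℝ) * (C₁ * (e : ℝ) ^ (η / 3) * (1 + L) ^ (i + 1 + j)) := by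
            rw [Finset.sum_const, nsmul_eq_mul]; field_simp
        _ ≤ (C₄ * (e : ℝ) ^ (η / 3)) * (C₁ * (e : ℝ) ^ (η / 3) * (1 + L) ^ (i + 1 + j)) := by
            gcongr
            exact h₄ e (by omega)
        _ = _ := by rw [Real.rpow_add he0]; ring
    have hrp : (e : ℝ) ^ (η / 3 + η / 3) ≤ (e : ℝ) ^ η := by
      refine Real.rpow_le_rpow_of_exponent_le he1 (by linarith)
    set S := ∑ d ∈ Icc 1 ⌊z⌋₊ with e ∣ d, (dk (j + 1) d : ℝ) / d * Real.log (z / d) ^ i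
    set T := ∑ a ∈ Icc 1 ⌊z⌋₊, (dk j a : ℝ) / a * Real.log (z / a) ^ (i + 1) * g a
    set c' := ∑ f ∈ e.divisors, (f.totient : ℝ) * c f
    have step5 : |S - 1 / (e * (i + 1)) * T| * (1 + L) ≤
        C₃ * C₂ * (e : ℝ) ^ (η - 1) * (1 + L) ^ (i + (j + 1)) := by
      calc _ ≤ 1 / e * ((C₃ * (e : ℝ) ^ (η / 3)) * (1 + L) ^ i) *
            ((C₂ * (e : ℝ) ^ (η / 3)) * (1 + L) ^ j) * (1 + L) := by
            gcongr
            refine step2.trans ?_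
            refine mul_le_mul ?_ (step3.trans ?_)
              (Finset.sum_nonneg fun _ _ => by positivity) (by positivity)
            · gcongr
              exact h₃ e he1
            · gcongr
              exact h₂ e (by omega)
        _ = C₃ * C₂ * ((e : ℝ) ^ (η / 3 + η / 3) / e) * (1 + L) ^ (i + (j + 1)) := by
            rw [Real.rpow_add he0]; ring
        _ ≤ C₃ * C₂ * ((e : ℝ) ^ η / e) * (1 + L) ^ (i + (j + 1)) := by gcongr
        _ = _ := by rw [Real.rpow_sub he0, Real.rpow_one]
    have step6 : |1 / (e * (i + 1)) * T - 1 / (e * (i + 1)) * c' * L ^ (i + (j + 1))| * (1 + L) ≤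
        C₄ * C₁ * (e : ℝ) ^ (η - 1) * (1 + L) ^ (i + (j + 1)) := by
      rw [mul_assoc _ c', ← mul_sub, abs_mul, abs_of_nonneg (by positivity)]
      have hidx : i + (j + 1) = i + 1 + j := by ring
      rw [hidx, mul_assoc]
      calc _ ≤ 1 / ((e : ℝ) * 1) * (C₄ * C₁ * (e : ℝ) ^ (η / 3 + η / 3) * (1 + L) ^ (i + 1 + j)) := by
            gcongr
            linarith [Nat.cast_nonneg (α := ℝ) i]
        _ = C₄ * C₁ * ((e : ℝ) ^ (η / 3 + η / 3) / e) * (1 + L) ^ (i + 1 + j) := by ring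
        _ ≤ C₄ * C₁ * ((e : ℝ) ^ η / e) * (1 + L) ^ (i + 1 + j) := by gcongr
        _ = _ := by rw [Real.rpow_sub he0, Real.rpow_one]
    calc _ ≤ (|S - 1 / (e * (i + 1)) * T| +
          |1 / (e * (i + 1)) * T - 1 / (e * (i + 1)) * c' * L ^ (i + (j + 1))|) * (1 + L) := by
          gcongr
          exact abs_sub_le _ _ _
      _ ≤ _ := by
          rw [add_mul]
          refine (add_le_add step5 step6).trans (le_of_eq ?_)
          ring

/-! ### The partial divisor function summed over multiples. -/

theorem sum_mul_partialDk (j N a : ℕ) (A : ℝ) (G : ℕ → ℝ) :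
    ∑ n ∈ Icc 1 N, (partialDk (j + 1) (n + a) A : ℝ) * G n =
      ∑ q ∈ Icc 1 (N + a), (dk j q : ℝ) *
        ∑ n ∈ Icc 1 N with q ∣ n + a ∧ (q : ℝ) ≤ ((n + a : ℕ) : ℝ) ^ A, G n := by
  simp only [partialDk, Nat.add_sub_cancel, Nat.cast_sum, Finset.sum_mul, Finset.mul_sum]
  refine Finset.sum_comm' fun n q => ?_
  simp only [mem_Icc, Nat.mem_divisors, mem_filter]
  constructor
  · rintro ⟨⟨h1, h2⟩, ⟨h3, h4⟩, h5⟩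
    have h6 := Nat.le_of_dvd (by omega) h3
    exact ⟨⟨⟨h1, h2⟩, h3, h5⟩, Nat.pos_of_dvd_of_pos h3 (by omega), by omega⟩
  · rintro ⟨⟨⟨h1, h2⟩, h3, h5⟩, h4, h6⟩
    exact ⟨⟨h1, h2⟩, ⟨h3, by omega⟩, h5⟩

theorem card_Icc_filter_dvd (N : ℕ) {e : ℕ} (he : 1 ≤ e) :
    (#{n ∈ Icc 1 N | e ∣ n} : ℕ) = N / e := by
  rw [Finset.card_eq_sum_ones, sum_Icc_filter_dvd N he]
  simp

/-- A bound interpolating between `1` and `u`: applied to `u = N / lcm(d, D)`, it retains a saving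
in `D` that the error bound `1` would lose. -/
theorem abs_floor_sub_le_rpow {u η : ℝ} (hu : 0 < u) (h0 : 0 ≤ η) (h1 : η ≤ 1) :
    |(⌊u⌋₊ : ℝ) - u| ≤ u ^ (1 - η) := by
  rcases lt_or_ge u 1 with h | h
  · rw [Nat.floor_eq_zero.2 h]
    simp only [Nat.cast_zero, zero_sub, abs_neg, abs_of_pos hu]
    conv_lhs => rw [← Real.rpow_one u]
    exact Real.rpow_le_rpow_of_exponent_ge hu h.le (by linarith)
  · have h2 := Nat.floor_le hu.le
    have h3 := Nat.lt_floor_add_one u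
    have h4 : 1 ≤ u ^ (1 - η) := Real.one_le_rpow h (by linarith)
    rw [abs_le]; constructor <;> linarith

theorem le_rpow_iff_rpow_one_div_le {B x y : ℝ} (hB : 0 < B) (hx : 0 ≤ x) (hy : 0 ≤ y) :
    x ≤ y ^ B ↔ x ^ (1 / B) ≤ y := by
  rw [one_div, Real.rpow_inv_le_iff_of_pos hx hy hB]

/-- The condition `d ≤ n^B` is the lower cutoff `n ≥ d^(1/B)`, so the count is of multiples of
`lcm(d, D)` in an interval; the second error term counts the multiples lost below the cutoff. -/
theorem abs_card_multiples_above_sub_le {B η : ℝ} (hB : 0 < B) (h0 : 0 ≤ η) (h1 : η ≤ 1)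
    {N d D : ℕ} (hN : 1 ≤ N) (hd : 1 ≤ d) (hD : 1 ≤ D) :
    |(#{n ∈ Icc 1 N | (d ∣ n ∧ (d : ℝ) ≤ (n : ℝ) ^ B) ∧ D ∣ n} : ℝ) - N / (d.lcm D : ℕ)| ≤
      ((N : ℝ) / (d.lcm D : ℕ)) ^ (1 - η) + (d : ℝ) ^ (1 / B) / (d.lcm D : ℕ) := by
  have hL : 1 ≤ d.lcm D := Nat.lcm_pos hd hD
  have hL0 : (0 : ℝ) < (d.lcm D : ℕ) := by exact_mod_cast hL
  have hN0 : (0 : ℝ) < N := by exact_mod_cast hN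
  set L := d.lcm D
  have hsplit : #{n ∈ Icc 1 N | (d ∣ n ∧ (d : ℝ) ≤ (n : ℝ) ^ B) ∧ D ∣ n} +
      #{n ∈ Icc 1 N | L ∣ n ∧ ¬ (d : ℝ) ≤ (n : ℝ) ^ B} = N / L := by
    rw [← card_Icc_filter_dvd N hL, ← Finset.card_filter_add_card_filter_not
      (s := {n ∈ Icc 1 N | L ∣ n}) (fun n : ℕ => (d : ℝ) ≤ (n : ℝ) ^ B), Finset.filter_filter,
      Finset.filter_filter]
    congr 2
    ext n
    simp only [mem_filter, L, Nat.lcm_dvd_iff]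
    tauto
  have hsmall : (#{n ∈ Icc 1 N | L ∣ n ∧ ¬ (d : ℝ) ≤ (n : ℝ) ^ B} : ℝ) ≤ (d : ℝ) ^ (1 / B) / L := by
    calc (#{n ∈ Icc 1 N | L ∣ n ∧ ¬ (d : ℝ) ≤ (n : ℝ) ^ B} : ℝ)
        ≤ #{n ∈ Icc 1 ⌊(d : ℝ) ^ (1 / B)⌋₊ | L ∣ n} := by
          refine Nat.cast_le.2 (Finset.card_le_card fun n hn => ?_)
          simp only [mem_filter, mem_Icc] at hn ⊢
          refine ⟨⟨hn.1.1, Nat.le_floor ?_⟩, hn.2.1⟩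
          rw [le_rpow_iff_rpow_one_div_le hB (by positivity) (by positivity)] at hn
          exact (not_le.1 hn.2.2).le
      _ = ((⌊(d : ℝ) ^ (1 / B)⌋₊ / L : ℕ) : ℝ) := by rw [card_Icc_filter_dvd _ hL]
      _ ≤ (⌊(d : ℝ) ^ (1 / B)⌋₊ : ℝ) / L := Nat.cast_div_le
      _ ≤ _ := by
          gcongr
          exact Nat.floor_le (by positivity)
  have hfl := abs_floor_sub_le_rpow (u := (N : ℝ) / L) (by positivity) h0 h1
  rw [Nat.floor_div_eq_div, ← hsplit, abs_le] at hfl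
  push_cast at hfl
  have hnn : (0 : ℝ) ≤ #{n ∈ Icc 1 N | L ∣ n ∧ ¬ (d : ℝ) ≤ (n : ℝ) ^ B} := by positivity
  have : 0 ≤ (d : ℝ) ^ (1 / B) / L := by positivity
  rw [abs_le]
  constructor <;> linarith [hfl.1, hfl.2]

/-- The point is that `c` is chosen before `B`: the cutoff `z = N^B` enters the main term only
through `log z = B log N`. After division by `B^(j+1)` the main terms for two values of `B` cancel.
-/
theorem exists_sum_partialDk_filter_dvd_asymp (j : ℕ) : ∃ c : ℕ → ℝ, ∀ B : ℝ, 0 < B → B ≤ 1 →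
    ∃ C : ℝ, 0 ≤ C ∧ ∀ N D : ℕ, 1 ≤ N → 1 ≤ D →
      |∑ n ∈ Icc 1 N with D ∣ n, (partialDk (j + 2) n B : ℝ)
        - B ^ (j + 1) * (c D * N * Real.log N ^ (j + 1))| ≤
        C * (N * (D : ℝ) ^ (-(3 / 4) : ℝ) * (1 + Real.log N) ^ j) := by
  obtain ⟨c, hc⟩ := exists_sum_dk_mul_log_pow_asymp (j + 1) 0
  obtain ⟨C₁, hC₁, h₁⟩ := hc (1 / 8) (by norm_num)
  obtain ⟨C₂, hC₂, h₂⟩ := exists_dk_le_rpow (j + 2) (η := 1 / 8) (by norm_num)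
  obtain ⟨C₃, hC₃, h₃⟩ := exists_card_divisors_le_rpow (η := 1 / 8) (by norm_num)
  refine ⟨fun D => 1 / D * ∑ e ∈ D.divisors, (e.totient : ℝ) * c e, fun B hB hB1 =>
    ⟨8 * C₂ + 8 * C₂ + C₃ * C₁, by positivity, fun N D hN hD => ?_⟩⟩
  have hN1 : (1 : ℝ) ≤ N := by exact_mod_cast hN
  have hN0 : (0 : ℝ) < N := by linarith
  have hD1 : (1 : ℝ) ≤ D := by exact_mod_cast hD
  have hD0 : (0 : ℝ) < D := by linarith
  set z : ℝ := (N : ℝ) ^ B with hz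
  have hz1 : 1 ≤ z := Real.one_le_rpow hN1 hB.le
  have hz0 : 0 < z := by linarith
  have hzN : z ≤ N := by
    calc z ≤ (N : ℝ) ^ (1 : ℝ) := Real.rpow_le_rpow_of_exponent_le hN1 hB1
      _ = N := Real.rpow_one _
  have hlz : Real.log z = B * Real.log N := Real.log_rpow hN0 B
  have hlz0 : 0 ≤ Real.log z := Real.log_nonneg hz1
  have hlzN : Real.log z ≤ Real.log N := Real.log_le_log hz0 hzN
  set Λ := (1 + Real.log N) ^ j with hΛ
  have hΛz : (1 + Real.log z) ^ j ≤ Λ := pow_le_pow_left₀ (by linarith) (by linarith) j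
  have hΛ0 : 0 ≤ Λ := by have := Real.log_nonneg hN1; positivity
  set cnt : ℕ → ℝ := fun d => #{n ∈ Icc 1 N | (d ∣ n ∧ (d : ℝ) ≤ (n : ℝ) ^ B) ∧ D ∣ n} with hcnt
  have e1 : ∑ n ∈ Icc 1 N with D ∣ n, (partialDk (j + 2) n B : ℝ) =
      ∑ d ∈ Icc 1 ⌊z⌋₊, (dk (j + 1) d : ℝ) * cnt d := by
    have hsw := sum_mul_partialDk (j + 1) N 0 B (fun n => if D ∣ n then 1 else 0)
    simp only [add_zero] at hsw
    rw [Finset.sum_filter]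
    refine Eq.trans (Finset.sum_congr rfl fun n _ => ?_) (hsw.trans ?_)
    · simp
    symm
    calc _ = ∑ d ∈ Icc 1 ⌊z⌋₊, (dk (j + 1) d : ℝ) * ∑ n ∈ Icc 1 N with (d ∣ n ∧ (d : ℝ) ≤ (n : ℝ) ^ B),
            if D ∣ n then 1 else 0 := by
          refine Finset.sum_congr rfl fun d _ => ?_
          simp [hcnt, Finset.filter_filter]
      _ = _ := by
          refine Finset.sum_subset (Finset.Icc_subset_Icc_right ?_) fun d hd hd' => ?_
          · exact Nat.floor_le_of_le hzN
          · rw [Finset.sum_eq_zero, mul_zero]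
            intro n hn
            exfalso
            simp only [mem_filter, mem_Icc] at hn hd hd'
            refine hd' ⟨hd.1, Nat.le_floor (hn.2.2.trans ?_)⟩
            rw [hz]
            gcongr
            exact hn.1.2
  have hlcm : ∀ d : ℕ, 1 ≤ d → (1 : ℝ) / (d.lcm D : ℕ) = 1 / D * ((d.gcd D : ℕ) / d) := by
    intro d hd
    have hd0 : (0 : ℝ) < d := by exact_mod_cast hd
    have h1 : ((d.gcd D : ℕ) : ℝ) * (d.lcm D : ℕ) = d * D := by exact_mod_cast Nat.gcd_mul_lcm d D
    have h2 : (0 : ℝ) < (d.lcm D : ℕ) := by exact_mod_cast Nat.lcm_pos hd hD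
    field_simp
    linarith
  have hP := sum_dk_mul_gcd_mul_rpow_le j (η := 1 / 8) (by norm_num) (by norm_num) hz1
    (D := D) (by omega)
  have hdkD : (dk (j + 2) D : ℝ) ≤ C₂ * (D : ℝ) ^ (1 / 8 : ℝ) := h₂ D (by omega)
  -- The exponent `-3/4`: the counting error saves `D^(7/8)`, and `dk (j+2) D` loses `D^(1/8)`.
  have hDexp : (D : ℝ) ^ (1 / 8 : ℝ) / (D : ℝ) ^ (1 - 1 / 8 : ℝ) = (D : ℝ) ^ (-(3 / 4) : ℝ) := by
    rw [← Real.rpow_sub hD0]; norm_num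
  have e2 : |∑ d ∈ Icc 1 ⌊z⌋₊, (dk (j + 1) d : ℝ) * cnt d -
      ∑ d ∈ Icc 1 ⌊z⌋₊, (dk (j + 1) d : ℝ) * (N / (d.lcm D : ℕ))| ≤
      (8 * C₂ + 8 * C₂) * (N * (D : ℝ) ^ (-(3 / 4) : ℝ) * Λ) := by
    rw [← Finset.sum_sub_distrib]
    set Q := ∑ d ∈ Icc 1 ⌊z⌋₊,
      (dk (j + 1) d : ℝ) * (d : ℝ) ^ (1 / 8 - 1 : ℝ) * ((d.gcd D : ℕ) : ℝ)
    have hQ : Q ≤ 8 * C₂ * ((D : ℝ) ^ (1 / 8 : ℝ) * z ^ (1 / 8 : ℝ) * Λ) := by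
      refine hP.trans ?_
      calc _ ≤ (C₂ * (D : ℝ) ^ (1 / 8 : ℝ)) * (z ^ (1 / 8 : ℝ) / (1 / 8) * Λ) := by gcongr
        _ = _ := by ring
    calc _ ≤ ∑ d ∈ Icc 1 ⌊z⌋₊, ((N / D : ℝ) ^ (1 - 1 / 8 : ℝ) + N / D * z ^ (-(1 / 8) : ℝ)) *
          ((dk (j + 1) d : ℝ) * (d : ℝ) ^ (1 / 8 - 1 : ℝ) * ((d.gcd D : ℕ) : ℝ)) := by
          refine (Finset.abs_sum_le_sum_abs _ _).trans (Finset.sum_le_sum fun d hd => ?_)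
          obtain ⟨hd1, hdz⟩ := cast_mem_Icc_floor hd
          have hd1' : 1 ≤ d := (mem_Icc.1 hd).1
          have hd0 : (0 : ℝ) < d := by linarith
          have hg1 : (1 : ℝ) ≤ (d.gcd D : ℕ) := by
            exact_mod_cast Nat.gcd_pos_of_pos_left _ hd1'
          rw [← mul_sub, abs_mul, abs_of_nonneg (by positivity)]
          have hb := abs_card_multiples_above_sub_le hB (η := 1 / 8) (by norm_num) (by norm_num)
            hN hd1' hD
          have h3 : ((N : ℝ) / (d.lcm D : ℕ)) ^ (1 - 1 / 8 : ℝ) ≤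
              (N / D : ℝ) ^ (1 - 1 / 8 : ℝ) * ((d : ℝ) ^ (1 / 8 - 1 : ℝ) * (d.gcd D : ℕ)) := by
            rw [div_eq_mul_one_div, hlcm d hd1']
            have h4 : (N : ℝ) * (1 / D * ((d.gcd D : ℕ) / d)) = N / D * ((d.gcd D : ℕ) * (d : ℝ)⁻¹) := by
              ring
            rw [h4, Real.mul_rpow (by positivity) (by positivity),
              Real.mul_rpow (by positivity) (by positivity), Real.inv_rpow hd0.le,
              ← Real.rpow_neg hd0.le, neg_sub, mul_comm ((d.gcd D : ℕ) ^ _ : ℝ)]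
            gcongr
            calc ((d.gcd D : ℕ) : ℝ) ^ (1 - 1 / 8 : ℝ) ≤ ((d.gcd D : ℕ) : ℝ) ^ (1 : ℝ) :=
                  Real.rpow_le_rpow_of_exponent_le hg1 (by norm_num)
              _ = _ := Real.rpow_one _
          have h5 : (d : ℝ) ^ (1 / B) / (d.lcm D : ℕ) ≤
              N / D * z ^ (-(1 / 8) : ℝ) * ((d : ℝ) ^ (1 / 8 - 1 : ℝ) * (d.gcd D : ℕ)) := by
            rw [div_eq_mul_one_div, hlcm d hd1']
            -- Since `N = z^(1/B)`, the left side is `N (d/z)^(1/B)`; as `d ≤ z` and `1/B ≥ 1/8`,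
            -- the exponent may be lowered to `1/8`.
            have h6 : (d : ℝ) ^ (1 / B) ≤ N * ((d : ℝ) ^ (1 / 8 : ℝ) * z ^ (-(1 / 8) : ℝ)) := by
              have h7 : (d : ℝ) ^ (1 / B) = N * (d / z) ^ (1 / B) := by
                rw [Real.div_rpow hd0.le hz0.le, hz, ← Real.rpow_mul hN0.le,
                  mul_one_div_cancel hB.ne', Real.rpow_one]
                field_simp
              rw [h7, Real.rpow_neg hz0.le, ← div_eq_mul_inv, ← Real.div_rpow hd0.le hz0.le]
              refine mul_le_mul_of_nonneg_left ?_ hN0.le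
              refine Real.rpow_le_rpow_of_exponent_ge (by positivity) (by rwa [div_le_one hz0]) ?_
              rw [le_div_iff₀ hB]; linarith
            calc _ ≤ N * ((d : ℝ) ^ (1 / 8 : ℝ) * z ^ (-(1 / 8) : ℝ)) *
                  (1 / D * ((d.gcd D : ℕ) / d)) := by gcongr
              _ = _ := by rw [Real.rpow_sub hd0, Real.rpow_one]; ring
          calc _ ≤ (dk (j + 1) d : ℝ) * (((N : ℝ) / (d.lcm D : ℕ)) ^ (1 - 1 / 8 : ℝ) +
                (d : ℝ) ^ (1 / B) / (d.lcm D : ℕ)) := by gcongr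
            _ ≤ (dk (j + 1) d : ℝ) *
                ((N / D : ℝ) ^ (1 - 1 / 8 : ℝ) * ((d : ℝ) ^ (1 / 8 - 1 : ℝ) * (d.gcd D : ℕ)) +
                  N / D * z ^ (-(1 / 8) : ℝ) * ((d : ℝ) ^ (1 / 8 - 1 : ℝ) * (d.gcd D : ℕ))) := by
                gcongr
            _ = _ := by ring
      _ = ((N / D : ℝ) ^ (1 - 1 / 8 : ℝ) + N / D * z ^ (-(1 / 8) : ℝ)) * Q := by
          rw [← Finset.mul_sum]
      _ ≤ ((N / D : ℝ) ^ (1 - 1 / 8 : ℝ) + N / D * z ^ (-(1 / 8) : ℝ)) *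
          (8 * C₂ * ((D : ℝ) ^ (1 / 8 : ℝ) * z ^ (1 / 8 : ℝ) * Λ)) := by gcongr
      _ = 8 * C₂ * (((N / D : ℝ) ^ (1 - 1 / 8 : ℝ) * z ^ (1 / 8 : ℝ)) * (D : ℝ) ^ (1 / 8 : ℝ) * Λ) +
          8 * C₂ * ((N / D * z ^ (-(1 / 8) : ℝ) * z ^ (1 / 8 : ℝ)) * (D : ℝ) ^ (1 / 8 : ℝ) * Λ) := by
          ring
      _ ≤ 8 * C₂ * ((N / (D : ℝ) ^ (1 - 1 / 8 : ℝ)) * (D : ℝ) ^ (1 / 8 : ℝ) * Λ) +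
          8 * C₂ * ((N / (D : ℝ) ^ (1 - 1 / 8 : ℝ)) * (D : ℝ) ^ (1 / 8 : ℝ) * Λ) := by
          gcongr
          · rw [Real.div_rpow hN0.le hD0.le, div_mul_eq_mul_div]
            gcongr
            calc (N : ℝ) ^ (1 - 1 / 8 : ℝ) * z ^ (1 / 8 : ℝ)
                ≤ (N : ℝ) ^ (1 - 1 / 8 : ℝ) * (N : ℝ) ^ (1 / 8 : ℝ) := by gcongr
              _ = N := by rw [← Real.rpow_add hN0]; norm_num
          · rw [mul_assoc, ← Real.rpow_add hz0, neg_add_cancel, Real.rpow_zero, mul_one]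
            gcongr
            calc (D : ℝ) ^ (1 - 1 / 8 : ℝ) ≤ (D : ℝ) ^ (1 : ℝ) :=
                  Real.rpow_le_rpow_of_exponent_le hD1 (by norm_num)
              _ = D := Real.rpow_one _
      _ = _ := by rw [← hDexp]; ring
  have e3 : ∑ d ∈ Icc 1 ⌊z⌋₊, (dk (j + 1) d : ℝ) * (N / (d.lcm D : ℕ)) =
      N / D * ∑ e ∈ D.divisors, (e.totient : ℝ) *
        ∑ d ∈ Icc 1 ⌊z⌋₊ with e ∣ d, (dk (j + 1) d : ℝ) / d := by
    rw [← sum_mul_gcd _ D (by omega), Finset.mul_sum]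
    refine Finset.sum_congr rfl fun d hd => ?_
    rw [div_eq_mul_one_div, hlcm d (mem_Icc.1 hd).1]
    ring
  have e4 : |∑ e ∈ D.divisors, (e.totient : ℝ) * ∑ d ∈ Icc 1 ⌊z⌋₊ with e ∣ d, (dk (j + 1) d : ℝ) / d
      - (∑ e ∈ D.divisors, (e.totient : ℝ) * c e) * Real.log z ^ (j + 1)| ≤
      C₃ * C₁ * (D : ℝ) ^ (1 / 4 : ℝ) * Λ := by
    rw [Finset.sum_mul, ← Finset.sum_sub_distrib]
    calc _ ≤ ∑ e ∈ D.divisors, C₁ * (D : ℝ) ^ (1 / 8 : ℝ) * Λ := by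
          refine (Finset.abs_sum_le_sum_abs _ _).trans (Finset.sum_le_sum fun e he => ?_)
          have he1 : 1 ≤ e := Nat.pos_of_mem_divisors he
          have he0 : (0 : ℝ) < e := by exact_mod_cast he1
          rw [mul_assoc, ← mul_sub, abs_mul, abs_of_nonneg (by positivity)]
          have h4 := h₁ e he1 z hz1
          simp only [pow_zero, mul_one, zero_add] at h4
          rw [pow_succ (1 + Real.log z), ← mul_assoc] at h4
          have h5 := le_of_mul_le_mul_right h4 (by linarith)
          calc _ ≤ (e : ℝ) * (C₁ * (e : ℝ) ^ (1 / 8 - 1 : ℝ) * (1 + Real.log z) ^ j) :=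
                mul_le_mul (by exact_mod_cast Nat.totient_le e) h5 (by positivity) (by positivity)
            _ = C₁ * (e : ℝ) ^ (1 / 8 : ℝ) * (1 + Real.log z) ^ j := by
                rw [Real.rpow_sub he0, Real.rpow_one]; field_simp
            _ ≤ _ := by
                gcongr
                exact Nat.divisor_le he
      _ = (D.divisors.card : ℝ) * (C₁ * (D : ℝ) ^ (1 / 8 : ℝ) * Λ) := by
          rw [Finset.sum_const, nsmul_eq_mul]
      _ ≤ (C₃ * (D : ℝ) ^ (1 / 8 : ℝ)) * (C₁ * (D : ℝ) ^ (1 / 8 : ℝ) * Λ) := by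
          gcongr
          exact h₃ D (by omega)
      _ = C₃ * C₁ * ((D : ℝ) ^ (1 / 8 : ℝ) * (D : ℝ) ^ (1 / 8 : ℝ)) * Λ := by ring
      _ = _ := by rw [← Real.rpow_add hD0]; norm_num
  rw [e1]
  have e5 : |∑ d ∈ Icc 1 ⌊z⌋₊, (dk (j + 1) d : ℝ) * (N / (d.lcm D : ℕ)) -
      B ^ (j + 1) * (1 / D * (∑ e ∈ D.divisors, (e.totient : ℝ) * c e) * N * Real.log N ^ (j + 1))| ≤
      C₃ * C₁ * (N * (D : ℝ) ^ (-(3 / 4) : ℝ) * Λ) := by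
    have h6 : B ^ (j + 1) * (1 / D * (∑ e ∈ D.divisors, (e.totient : ℝ) * c e) * N *
        Real.log N ^ (j + 1)) =
        N / D * ((∑ e ∈ D.divisors, (e.totient : ℝ) * c e) * Real.log z ^ (j + 1)) := by
      rw [hlz, mul_pow]; ring
    rw [e3, h6, ← mul_sub, abs_mul, abs_of_nonneg (by positivity)]
    calc _ ≤ (N / D : ℝ) * (C₃ * C₁ * (D : ℝ) ^ (1 / 4 : ℝ) * Λ) := by gcongr
      _ = C₃ * C₁ * (N * ((D : ℝ) ^ (1 / 4 : ℝ) / (D : ℝ) ^ (1 : ℝ)) * Λ) := by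
          rw [Real.rpow_one]; ring
      _ = _ := by rw [← Real.rpow_sub hD0]; norm_num
  refine (abs_sub_le _ _ _).trans ((add_le_add e2 e5).trans (le_of_eq ?_))
  ring

/-! ### Equidistribution among residue classes with equal gcd. -/

/-- The sum of `F n` over `1 ≤ n ≤ x` with `n ≡ r (mod q)`. -/
noncomputable def sumClass (F : ℕ → ℝ) (q r : ℕ) (x : ℝ) : ℝ :=
  ∑ n ∈ Icc 1 ⌊x⌋₊ with n ≡ r [MOD q], F n

/-- `F` has, with a power saving, the same sum over any two residue classes modulo `q ≤ x ^ α`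
that have the same greatest common divisor with `q`. -/
def Equidistributed (F : ℕ → ℝ) (α : ℝ) : Prop :=
  ∀ g : ℕ, 1 ≤ g → ∃ δ : ℝ, 0 < δ ∧ ∃ C : ℝ, 0 ≤ C ∧ ∀ x : ℝ, 1 ≤ x →
    ∀ q r r' : ℕ, 1 ≤ q → (q : ℝ) ≤ x ^ α → r.gcd q = g → r'.gcd q = g →
      |sumClass F q r x - sumClass F q r' x| ≤ C * (x ^ (1 - δ) / q)

theorem rpow_one_sub_le {x δ δ' : ℝ} (hx : 1 ≤ x) (h : δ' ≤ δ) : x ^ (1 - δ) ≤ x ^ (1 - δ') :=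
  Real.rpow_le_rpow_of_exponent_le hx (by linarith)

/-- The constants in `Equidistributed` depend on the gcd; only finitely many values divide `h`, so a
least `δ` and a largest `C` serve for all of them. -/
theorem Equidistributed.exists_uniform {F : ℕ → ℝ} {α : ℝ} (hF : Equidistributed F α) {h : ℕ}
    (hh : 1 ≤ h) : ∃ δ : ℝ, 0 < δ ∧ δ ≤ 1 ∧ ∃ C : ℝ, 0 ≤ C ∧ ∀ x : ℝ, 1 ≤ x →
    ∀ q r r' : ℕ, 1 ≤ q → (q : ℝ) ≤ x ^ α → r.gcd q ∣ h → r'.gcd q = r.gcd q →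
      |sumClass F q r x - sumClass F q r' x| ≤ C * (x ^ (1 - δ) / q) := by
  have key : ∀ s : Finset ℕ, (∀ g ∈ s, 1 ≤ g) → ∃ δ : ℝ, 0 < δ ∧ δ ≤ 1 ∧ ∃ C : ℝ, 0 ≤ C ∧
      ∀ x : ℝ, 1 ≤ x → ∀ q r r' : ℕ, 1 ≤ q → (q : ℝ) ≤ x ^ α → r.gcd q ∈ s →
        r'.gcd q = r.gcd q → |sumClass F q r x - sumClass F q r' x| ≤ C * (x ^ (1 - δ) / q) := by
    intro s
    induction s using Finset.induction_on with
    | empty => exact fun _ => ⟨1, one_pos, le_rfl, 0, le_rfl, by simp⟩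
    | insert g s _ ih =>
      intro hs
      obtain ⟨δ₁, h₁, h₁', C₁, hC₁, H₁⟩ := ih fun g hg => hs g (mem_insert_of_mem hg)
      obtain ⟨δ₂, h₂, C₂, hC₂, H₂⟩ := hF g (hs g (mem_insert_self _ _))
      refine ⟨min δ₁ δ₂, lt_min h₁ h₂, (min_le_left _ _).trans h₁', max C₁ C₂,
        hC₁.trans (le_max_left _ _), fun x hx q r r' hq hqx hr hr' => ?_⟩
      rcases mem_insert.1 hr with h | h
      · refine (H₂ x hx q r r' hq hqx h (hr'.trans h)).trans ?_
        gcongr ?_ * (?_ / _)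
        · exact le_max_right _ _
        · exact rpow_one_sub_le hx (min_le_right _ _)
      · refine (H₁ x hx q r r' hq hqx h hr').trans ?_
        gcongr ?_ * (?_ / _)
        · exact le_max_left _ _
        · exact rpow_one_sub_le hx (min_le_left _ _)
  obtain ⟨δ, h1, h2, C, hC, H⟩ := key h.divisors fun g hg => Nat.pos_of_mem_divisors hg
  exact ⟨δ, h1, h2, C, hC, fun x hx q r r' hq hqx hr => H x hx q r r' hq hqx
    (Nat.mem_divisors.2 ⟨hr, by omega⟩)⟩

theorem Equidistributed.sub {F G : ℕ → ℝ} {α : ℝ} (hF : Equidistributed F α)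
    (hG : Equidistributed G α) : Equidistributed (fun n => F n - G n) α := by
  intro g hg
  obtain ⟨δ₁, h₁, C₁, hC₁, H₁⟩ := hF g hg
  obtain ⟨δ₂, h₂, C₂, hC₂, H₂⟩ := hG g hg
  refine ⟨min δ₁ δ₂, lt_min h₁ h₂, C₁ + C₂, by positivity, fun x hx q r r' hq hqx hr hr' => ?_⟩
  have e1 := H₁ x hx q r r' hq hqx hr hr'
  have e2 := H₂ x hx q r r' hq hqx hr hr'
  have hs : ∀ r, sumClass (fun n => F n - G n) q r x = sumClass F q r x - sumClass G q r x :=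
    fun r => Finset.sum_sub_distrib _ _
  rw [hs, hs]
  calc _ = |(sumClass F q r x - sumClass F q r' x) - (sumClass G q r x - sumClass G q r' x)| := by
        congr 1; ring
    _ ≤ C₁ * (x ^ (1 - δ₁) / q) + C₂ * (x ^ (1 - δ₂) / q) := (abs_sub _ _).trans (add_le_add e1 e2)
    _ ≤ C₁ * (x ^ (1 - min δ₁ δ₂) / q) + C₂ * (x ^ (1 - min δ₁ δ₂) / q) := by
        gcongr C₁ * (?_ / _) + C₂ * (?_ / _)
        · exact rpow_one_sub_le hx (min_le_left _ _)
        · exact rpow_one_sub_le hx (min_le_right _ _)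
    _ = _ := by ring

theorem Equidistributed.const_mul {F : ℕ → ℝ} {α : ℝ} (hF : Equidistributed F α) (c : ℝ) :
    Equidistributed (fun n => c * F n) α := by
  intro g hg
  obtain ⟨δ₁, h₁, C₁, hC₁, H₁⟩ := hF g hg
  refine ⟨δ₁, h₁, |c| * C₁, by positivity, fun x hx q r r' hq hqx hr hr' => ?_⟩
  have hs : ∀ r, sumClass (fun n => c * F n) q r x = c * sumClass F q r x :=
    fun r => (Finset.mul_sum _ _ _).symm
  rw [hs, hs, ← mul_sub, abs_mul, mul_assoc]
  gcongr
  exact H₁ x hx q r r' hq hqx hr hr'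

/-! ### The divisor weight and bounds for the reciprocal of the totient. -/

/-- The weight `∑ e ^ (-3/4)` over the divisors `e` of `n`. -/
noncomputable def divisorWeight (n : ℕ) : ℝ := ∑ e ∈ n.divisors, (e : ℝ) ^ (-(3 / 4) : ℝ)

theorem one_le_divisorWeight {n : ℕ} (hn : n ≠ 0) : 1 ≤ divisorWeight n := by
  have := Finset.single_le_sum (s := n.divisors) (f := fun e : ℕ => (e : ℝ) ^ (-(3 / 4) : ℝ))
    (fun _ _ => by positivity) (Nat.one_mem_divisors.2 hn)
  simpa [divisorWeight] using this

theorem divisorWeight_mono {m n : ℕ} (hn : n ≠ 0) (h : m ∣ n) :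
    divisorWeight m ≤ divisorWeight n :=
  Finset.sum_le_sum_of_subset_of_nonneg (Nat.divisors_subset_of_dvd hn h)
    fun _ _ _ => by positivity

theorem divisorWeight_le_card (n : ℕ) : divisorWeight n ≤ n.divisors.card := by
  rw [Finset.card_eq_sum_ones]
  push_cast
  refine Finset.sum_le_sum fun e he => ?_
  exact Real.rpow_le_one_of_one_le_of_nonpos (by exact_mod_cast Nat.pos_of_mem_divisors he)
    (by norm_num)

/-- The expanded product is the part of `divisorWeight n` carried by the squarefree divisors, each
being the product of a unique set of primes. -/
theorem prod_one_add_rpow_le_divisorWeight {n : ℕ} (hn : n ≠ 0) :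
    ∏ p ∈ n.primeFactors, (1 + (p : ℝ) ^ (-(3 / 4) : ℝ)) ≤ divisorWeight n := by
  rw [Finset.prod_one_add]
  have hinj : Set.InjOn (fun t : Finset ℕ => ∏ p ∈ t, p) (n.primeFactors.powerset : Set (Finset ℕ)) := by
    intro s hs t ht hst
    have hs' : ∀ p ∈ s, p.Prime := fun p hp =>
      Nat.prime_of_mem_primeFactors (Finset.mem_powerset.1 hs hp)
    have ht' : ∀ p ∈ t, p.Prime := fun p hp =>
      Nat.prime_of_mem_primeFactors (Finset.mem_powerset.1 ht hp)
    rw [← Nat.primeFactors_prod hs', ← Nat.primeFactors_prod ht']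
    exact congrArg _ hst
  calc _ = ∑ t ∈ n.primeFactors.powerset, ((∏ p ∈ t, p : ℕ) : ℝ) ^ (-(3 / 4) : ℝ) := by
        refine Finset.sum_congr rfl fun t _ => ?_
        push_cast
        rw [Real.finsetProd_rpow _ _ (fun _ _ => by positivity)]
    _ = ∑ e ∈ n.primeFactors.powerset.image (fun t : Finset ℕ => ∏ p ∈ t, p),
          (e : ℝ) ^ (-(3 / 4) : ℝ) := by rw [Finset.sum_image hinj]
    _ ≤ _ := by
        refine Finset.sum_le_sum_of_subset_of_nonneg ?_ fun _ _ _ => by positivity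
        intro e he
        obtain ⟨t, ht, rfl⟩ := Finset.mem_image.1 he
        refine Nat.mem_divisors.2 ⟨?_, hn⟩
        exact (Finset.prod_dvd_prod_of_subset _ _ _ (Finset.mem_powerset.1 ht)).trans
          (Nat.prod_primeFactors_dvd n)

theorem div_totient_le {n : ℕ} (hn : n ≠ 0) : (n : ℝ) / n.totient ≤ 32 * divisorWeight n := by
  have hφ : (0 : ℝ) < n.totient := by exact_mod_cast Nat.totient_pos.2 (Nat.pos_of_ne_zero hn)
  have hp2 : ∀ p ∈ n.primeFactors, (2 : ℝ) ≤ p := fun p hp => by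
    exact_mod_cast (Nat.prime_of_mem_primeFactors hp).two_le
  have h1 : (n : ℝ) / n.totient = ∏ p ∈ n.primeFactors, ((p : ℝ) / (p - 1)) := by
    have h := Nat.totient_mul_prod_primeFactors n
    have h' : (n.totient : ℝ) * ∏ p ∈ n.primeFactors, (p : ℝ) =
        n * ∏ p ∈ n.primeFactors, ((p : ℝ) - 1) := by
      have := congrArg (Nat.cast (R := ℝ)) h
      push_cast at this
      rw [this]
      congr 1
      refine Finset.prod_congr rfl fun p hp => ?_
      rw [Nat.cast_sub (Nat.prime_of_mem_primeFactors hp).one_le, Nat.cast_one]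
    rw [Finset.prod_div_distrib, div_eq_div_iff hφ.ne', ← h', mul_comm]
    exact (Finset.prod_pos fun p hp => by linarith [hp2 p hp]).ne'
  rw [h1]
  -- For `p ≥ 5` the Euler factor is at most `1 + p^(-3/4)`; smaller primes cost a factor 2 each,
  -- and their number is crudely bounded by 5, whence `32`.
  calc ∏ p ∈ n.primeFactors, ((p : ℝ) / (p - 1))
      ≤ ∏ p ∈ n.primeFactors, ((if p < 5 then 2 else 1) * (1 + (p : ℝ) ^ (-(3 / 4) : ℝ))) := by
        refine Finset.prod_le_prod (fun p hp => ?_) fun p hp => ?_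
        · have := hp2 p hp
          exact div_nonneg (by linarith) (by linarith)
        · have h2 := hp2 p hp
          have h0 : (0 : ℝ) < (p : ℝ) ^ (-(3 / 4) : ℝ) := Real.rpow_pos_of_pos (by linarith) _
          rw [div_le_iff₀ (by linarith)]
          split_ifs with h
          · nlinarith
          · have h5 : (5 : ℝ) ≤ p := by exact_mod_cast not_lt.1 h
            -- Bernoulli gives `p^(3/4) ≤ 1 + (3/4)(p - 1)`, which is at most `p - 1` exactly when
            -- `p ≥ 5`.
            have h6 : (p : ℝ) ^ (3 / 4 : ℝ) ≤ p - 1 := by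
              have := rpow_one_add_le_one_add_mul_self (s := (p : ℝ) - 1) (by linarith)
                (p := 3 / 4) (by norm_num) (by norm_num)
              rw [add_sub_cancel] at this
              linarith
            have h7 : 1 ≤ (p : ℝ) ^ (-(3 / 4) : ℝ) * (p - 1) := by
              rw [Real.rpow_neg (by linarith), inv_mul_eq_div, le_div_iff₀ (by positivity)]
              linarith
            nlinarith
    _ ≤ 32 * ∏ p ∈ n.primeFactors, (1 + (p : ℝ) ^ (-(3 / 4) : ℝ)) := by
        rw [Finset.prod_mul_distrib]
        refine mul_le_mul_of_nonneg_right ?_ (Finset.prod_nonneg fun _ _ => by positivity)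
        rw [Finset.prod_ite, Finset.prod_const, Finset.prod_const_one, mul_one]
        calc _ ≤ (2 : ℝ) ^ 5 := by
              refine pow_le_pow_right₀ (by norm_num) ?_
              calc _ ≤ (Finset.range 5).card := Finset.card_le_card fun p hp => by
                      simpa using (Finset.mem_filter.1 hp).2
                _ = 5 := by simp
          _ = 32 := by norm_num
    _ ≤ _ := by
        gcongr
        exact prod_one_add_rpow_le_divisorWeight hn

theorem exists_one_div_totient_le {η : ℝ} (hη : 0 < η) : ∃ C : ℝ, 0 ≤ C ∧ ∀ q g : ℕ, 1 ≤ q → g ∣ q →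
    1 / ((q / g).totient : ℝ) ≤ C * g * (q : ℝ) ^ η / q := by
  obtain ⟨C, hC, h⟩ := exists_card_divisors_le_rpow hη
  refine ⟨32 * C, by positivity, fun q g hq hg => ?_⟩
  obtain ⟨m, rfl⟩ := hg
  have hg0 : 0 < g := Nat.pos_of_mul_pos_right hq
  have hm0 : 0 < m := Nat.pos_of_mul_pos_left hq
  have hg0' : (0 : ℝ) < g := by exact_mod_cast hg0
  have hm0' : (0 : ℝ) < m := by exact_mod_cast hm0
  rw [Nat.mul_div_cancel_left _ hg0]
  have h1 := div_totient_le hm0.ne'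
  have h2 := (divisorWeight_le_card m).trans (h m hm0.ne')
  calc 1 / (m.totient : ℝ) = (m : ℝ) / m.totient / m := by field_simp
    _ ≤ 32 * (C * (m : ℝ) ^ η) / m := by gcongr; exact h1.trans (by gcongr)
    _ ≤ 32 * (C * ((g * m : ℕ) : ℝ) ^ η) / m := by
        gcongr
        exact Nat.le_mul_of_pos_left m hg0
    _ = _ := by push_cast; field_simp

/-! ### Levels of distribution of `dk` and of the partial divisor functions. -/

/-- Both classes are compared with the common expected value, which depends only on the gcd. Half of
the power saving pays for replacing `1/φ(q/g)` by `1/q`. -/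
theorem equidistributed_dk {k : ℕ} {θ α : ℝ}
    (hθ : ∀ g : ℕ, 1 ≤ g → IsExponentOfDistribution g k θ) (hα : α < θ) :
    Equidistributed (fun n => (dk k n : ℝ)) α := by
  intro g hg
  obtain ⟨_, hθ1, hE⟩ := hθ g hg
  obtain ⟨δ, hδ, C, H⟩ := hE (θ - α) (by linarith)
  obtain ⟨C', hC', H'⟩ := exists_one_div_totient_le (η := δ / 2) (by positivity)
  refine ⟨δ / 2, by positivity, 2 * |C| * C' * g, by positivity,
    fun x hx q r r' hq hqx hr hr' => ?_⟩
  have hx0 : 0 < x := by linarith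
  have hq0 : (0 : ℝ) < q := by exact_mod_cast hq
  have hgq : g ∣ q := hr ▸ Nat.gcd_dvd_right r q
  have hdef : ∀ r, sumClass (fun n => (dk k n : ℝ)) q r x = sumInClass k q r x := fun _ => rfl
  -- The zero class, excluded from the hypothesis, occurs only for `g = q`; then `r` and `r'` are
  -- the same class and nothing needs proof.
  by_cases h0 : g = q
  · have hr0 : r ≡ r' [MOD q] := by
      have h1 : q ∣ r := by rw [← h0, ← hr]; exact Nat.gcd_dvd_left r q
      have h2 : q ∣ r' := by rw [← h0, ← hr']; exact Nat.gcd_dvd_left r' q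
      exact ((Nat.modEq_zero_iff_dvd).2 h1).trans ((Nat.modEq_zero_iff_dvd).2 h2).symm
    have : sumClass (fun n => (dk k n : ℝ)) q r x = sumClass (fun n => (dk k n : ℝ)) q r' x := by
      unfold sumClass
      congr 1
      ext n
      simp only [mem_filter, and_congr_right_iff]
      exact fun _ => ⟨fun h => h.trans hr0, fun h => h.trans hr0.symm⟩
    rw [this, sub_self, abs_zero]
    positivity
  · have hne : ∀ r : ℕ, r.gcd q = g → ¬ r ≡ 0 [MOD q] := fun r hr h =>
      h0 (hr.symm.trans (Nat.gcd_eq_right ((Nat.modEq_zero_iff_dvd).1 h)))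
    have hqx' : (q : ℝ) ≤ x ^ (θ - (θ - α)) := by rwa [sub_sub_cancel]
    have key : ∀ r : ℕ, r.gcd q = g → |sumClass (fun n => (dk k n : ℝ)) q r x - expectedInClass k q g x|
        ≤ |C| * C' * g * (x ^ (1 - δ / 2) / q) := by
      intro r hr
      refine (H x hx q r hq hqx' (hne r hr) hr).trans ?_
      have hqx2 : (q : ℝ) ≤ x := by
        refine hqx.trans ((Real.rpow_le_rpow_of_exponent_le hx (by linarith)).trans_eq
          (Real.rpow_one x))
      calc C * (x ^ (1 - δ) / ((q / g).totient : ℝ))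
          ≤ |C| * (x ^ (1 - δ) * (1 / ((q / g).totient : ℝ))) := by
            rw [mul_one_div]
            gcongr
            exact le_abs_self C
        _ ≤ |C| * (x ^ (1 - δ) * (C' * g * (q : ℝ) ^ (δ / 2) / q)) := by
            exact mul_le_mul_of_nonneg_left (mul_le_mul_of_nonneg_left (H' q g hq hgq)
              (by positivity)) (by positivity)
        _ ≤ |C| * (x ^ (1 - δ) * (C' * g * x ^ (δ / 2) / q)) := by gcongr
        _ = |C| * C' * g * (x ^ (1 - δ) * x ^ (δ / 2) / q) := by ring
        _ = _ := by rw [← Real.rpow_add hx0]; ring_nf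
    have e1 := key r hr
    have e2 := key r' hr'
    rw [abs_sub_comm] at e2
    refine (abs_sub_le _ _ _).trans ((add_le_add e1 e2).trans (le_of_eq ?_))
    ring

theorem card_Ioc_modEq_bounds {L : ℕ} (hL : 1 ≤ L) {M N : ℕ} (hMN : M ≤ N) (v : ℕ) :
    ((N : ℝ) - M) / L - 1 ≤ #{n ∈ Ioc M N | n ≡ v [MOD L]} ∧
      (#{n ∈ Ioc M N | n ≡ v [MOD L]} : ℝ) ≤ ((N : ℝ) - M) / L + 1 := by
  have h := Nat.Ioc_filter_modEq_card M N hL v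
  have hL0 : (0 : ℚ) < L := by exact_mod_cast hL
  have hMN' : (M : ℚ) ≤ N := by exact_mod_cast hMN
  set a : ℚ := ((M : ℚ) - v) / L with ha
  set b : ℚ := ((N : ℚ) - v) / L with hb
  have hba : b - a = ((N : ℚ) - M) / L := by rw [ha, hb]; field_simp; ring
  have hab : a ≤ b := by
    have : 0 ≤ ((N : ℚ) - M) / L := div_nonneg (by linarith) hL0.le
    linarith
  rw [max_eq_left (sub_nonneg.2 (Int.floor_le_floor hab))] at h
  have h' : (#{n ∈ Ioc M N | n ≡ v [MOD L]} : ℚ) = (⌊b⌋ : ℚ) - ⌊a⌋ := by exact_mod_cast h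
  have f1 := Int.floor_le a
  have f2 := Int.lt_floor_add_one a
  have f3 := Int.floor_le b
  have f4 := Int.lt_floor_add_one b
  have h1 : ((N : ℚ) - M) / L - 1 ≤ #{n ∈ Ioc M N | n ≡ v [MOD L]} := by rw [h']; linarith
  have h2 : (#{n ∈ Ioc M N | n ≡ v [MOD L]} : ℚ) ≤ ((N : ℚ) - M) / L + 1 := by rw [h']; linarith
  constructor
  · have := (Rat.cast_le (K := ℝ)).2 h1
    push_cast at this
    exact this
  · have := (Rat.cast_le (K := ℝ)).2 h2
    push_cast at this
    exact this

theorem abs_card_Ioc_modEq_sub_le {L : ℕ} (hL : 1 ≤ L) (M N v v' : ℕ) :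
    |(#{n ∈ Ioc M N | n ≡ v [MOD L]} : ℝ) - #{n ∈ Ioc M N | n ≡ v' [MOD L]}| ≤ 2 := by
  rcases le_total M N with h | h
  · have h1 := card_Ioc_modEq_bounds hL h v
    have h2 := card_Ioc_modEq_bounds hL h v'
    rw [abs_le]; constructor <;> linarith [h1.1, h1.2, h2.1, h2.2]
  · simp [Finset.Ioc_eq_empty_of_le h]

/-- The multiples of `d` in a residue class modulo `q` form a residue class or are absent,
according to the greatest common divisor of the class with `q`. -/
theorem dvd_and_modEq_classes {q d r r' : ℕ} (hq : 1 ≤ q) (hd : 1 ≤ d)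
    (hr : r'.gcd q = r.gcd q) :
    ((∀ n, ¬ (d ∣ n ∧ n ≡ r [MOD q])) ∧ ∀ n, ¬ (d ∣ n ∧ n ≡ r' [MOD q])) ∨
    ∃ L v v' : ℕ, 1 ≤ L ∧ (∀ n, d ∣ n ∧ n ≡ r [MOD q] ↔ n ≡ v [MOD L]) ∧
      ∀ n, d ∣ n ∧ n ≡ r' [MOD q] ↔ n ≡ v' [MOD L] := by
  have key : ∀ r, d.gcd q ∣ r → ∃ v, ∀ n, d ∣ n ∧ n ≡ r [MOD q] ↔ n ≡ v [MOD d.lcm q] := by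
    intro r hr
    have hcomp : 0 ≡ r [MOD d.gcd q] := ((Nat.modEq_zero_iff_dvd).2 hr).symm
    obtain ⟨v, hv1, hv2⟩ := Nat.chineseRemainder' hcomp
    refine ⟨v, fun n => ?_⟩
    constructor
    · rintro ⟨h1, h2⟩
      have h3 : n ≡ v [MOD d] := ((Nat.modEq_zero_iff_dvd).2 h1).trans hv1.symm
      have h4 : n ≡ v [MOD q] := h2.trans hv2.symm
      have h3' := Int.natCast_modEq_iff.2 h3
      have h4' := Int.natCast_modEq_iff.2 h4
      have := (Int.modEq_and_modEq_iff_modEq_lcm).1 ⟨h3', h4'⟩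
      rw [← Int.natCast_modEq_iff]
      exact this
    · intro h
      exact ⟨(Nat.modEq_zero_iff_dvd).1 ((h.of_dvd (Nat.dvd_lcm_left _ _)).trans hv1),
        (h.of_dvd (Nat.dvd_lcm_right _ _)).trans hv2⟩
  have key2 : ∀ r n, d ∣ n ∧ n ≡ r [MOD q] → d.gcd q ∣ r := by
    rintro r n ⟨h1, h2⟩
    have h3 : d.gcd q ∣ n := (Nat.gcd_dvd_left _ _).trans h1
    exact ((h2.of_dvd (Nat.gcd_dvd_right d q)).dvd_iff dvd_rfl).1 h3
  have hiff : d.gcd q ∣ r ↔ d.gcd q ∣ r' := by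
    have : ∀ r : ℕ, d.gcd q ∣ r ↔ d.gcd q ∣ r.gcd q := fun r =>
      ⟨fun h => Nat.dvd_gcd h (Nat.gcd_dvd_right _ _), fun h => h.trans (Nat.gcd_dvd_left _ _)⟩
    rw [this r, this r', hr]
  by_cases h : d.gcd q ∣ r
  · obtain ⟨v, hv⟩ := key r h
    obtain ⟨v', hv'⟩ := key r' (hiff.1 h)
    exact Or.inr ⟨d.lcm q, v, v', Nat.lcm_pos hd hq, hv, hv'⟩
  · exact Or.inl ⟨fun n hn => h (key2 r n hn), fun n hn => h (hiff.2 (key2 r' n hn))⟩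

/-- For each divisor `d ≤ x^B`, the multiples of `d` in the two classes form progressions of the
same modulus in the same interval, or both are absent, so their counts differ by at most 2. The
total error is about `x^B`, which beats `x/q` by a power when `α + B < 1`. -/
theorem equidistributed_partialDk_of_add_lt_one (j : ℕ) {B α : ℝ} (hB : 0 < B)
    (hBα : α + B < 1) : Equidistributed (fun n => (partialDk (j + 1) n B : ℝ)) α := by
  intro g _
  -- One `δ` is spent on the divisor bound and one is the saving, since `B + δ = 1 - δ - α`.
  set δ := (1 - α - B) / 2 with hδ
  have hδ0 : 0 < δ := by rw [hδ]; linarith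
  obtain ⟨C, hC, H⟩ := exists_dk_le_rpow j hδ0
  refine ⟨δ, hδ0, 2 * C, by positivity, fun x hx q r r' hq hqx hr hr' => ?_⟩
  have hx0 : 0 < x := by linarith
  have hq0 : (0 : ℝ) < q := by exact_mod_cast hq
  set N := ⌊x⌋₊ with hN
  have hNx : (N : ℝ) ≤ x := Nat.floor_le hx0.le
  have hs : ∀ r, sumClass (fun n => (partialDk (j + 1) n B : ℝ)) q r x =
      ∑ d ∈ Icc 1 N, (dk j d : ℝ) *
        #{n ∈ Icc 1 N | (d ∣ n ∧ (d : ℝ) ≤ (n : ℝ) ^ B) ∧ n ≡ r [MOD q]} := by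
    intro r
    have hsw := sum_mul_partialDk j N 0 B (fun n => if n ≡ r [MOD q] then 1 else 0)
    simp only [add_zero] at hsw
    rw [sumClass, Finset.sum_filter]
    refine Eq.trans (Finset.sum_congr rfl fun n _ => ?_) (hsw.trans ?_)
    · simp
    · refine Finset.sum_congr rfl fun d _ => ?_
      rw [← Finset.sum_filter, Finset.filter_filter, Finset.sum_const, nsmul_one]
  have hcnt : ∀ d ∈ Icc 1 N,
      |(#{n ∈ Icc 1 N | (d ∣ n ∧ (d : ℝ) ≤ (n : ℝ) ^ B) ∧ n ≡ r [MOD q]} : ℝ) -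
        #{n ∈ Icc 1 N | (d ∣ n ∧ (d : ℝ) ≤ (n : ℝ) ^ B) ∧ n ≡ r' [MOD q]}| ≤
        if d ∈ Icc 1 ⌊x ^ B⌋₊ then 2 else 0 := by
    intro d hd
    have hd1 : 1 ≤ d := (mem_Icc.1 hd).1
    have hd0 : (0 : ℝ) < d := by exact_mod_cast hd1
    split_ifs with hdx
    -- The half-open interval `(M, N]` encodes `n ≥ d^(1/B)`; the ceiling is at least 1, so the
    -- truncated subtraction is exact.
    · set M := ⌈(d : ℝ) ^ (1 / B)⌉₊ - 1 with hM
      have hM1 : 1 ≤ ⌈(d : ℝ) ^ (1 / B)⌉₊ := Nat.one_le_ceil_iff.2 (by positivity)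
      have hset : ∀ r, {n ∈ Icc 1 N | (d ∣ n ∧ (d : ℝ) ≤ (n : ℝ) ^ B) ∧ n ≡ r [MOD q]} =
          {n ∈ Ioc M N | d ∣ n ∧ n ≡ r [MOD q]} := by
        intro r
        ext n
        simp only [mem_filter, mem_Icc, mem_Ioc]
        rw [le_rpow_iff_rpow_one_div_le hB hd0.le (by positivity), ← Nat.ceil_le]
        constructor
        · rintro ⟨⟨h1, h2⟩, ⟨h3, h4⟩, h5⟩
          exact ⟨⟨by omega, h2⟩, h3, h5⟩
        · rintro ⟨⟨h1, h2⟩, h3, h5⟩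
          exact ⟨⟨by omega, h2⟩, ⟨h3, by omega⟩, h5⟩
      rw [hset, hset]
      rcases dvd_and_modEq_classes hq hd1 (hr'.trans hr.symm) with ⟨h1, h2⟩ | ⟨L, v, v', hL, h1, h2⟩
      · simp [h1, h2]
      · simp only [h1, h2]
        exact abs_card_Ioc_modEq_sub_le hL M N v v'
    · have hempty : ∀ r, {n ∈ Icc 1 N | (d ∣ n ∧ (d : ℝ) ≤ (n : ℝ) ^ B) ∧ n ≡ r [MOD q]} = ∅ := by
        intro r
        refine Finset.filter_eq_empty_iff.2 fun n hn h => hdx ?_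
        refine mem_Icc.2 ⟨hd1, Nat.le_floor (h.1.2.trans ?_)⟩
        gcongr
        exact (Nat.cast_le.2 (mem_Icc.1 hn).2).trans hNx
      rw [hempty, hempty]; simp
  rw [hs, hs, ← Finset.sum_sub_distrib]
  calc _ ≤ ∑ d ∈ Icc 1 N, (C * x ^ δ) * (if d ∈ Icc 1 ⌊x ^ B⌋₊ then 2 else 0) := by
        refine (Finset.abs_sum_le_sum_abs _ _).trans (Finset.sum_le_sum fun d hd => ?_)
        rw [← mul_sub, abs_mul, abs_of_nonneg (by positivity)]
        have hd1 : 1 ≤ d := (mem_Icc.1 hd).1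
        refine mul_le_mul ?_ (hcnt d hd) (abs_nonneg _) (by positivity)
        refine (H d (by omega)).trans ?_
        gcongr
        exact (Nat.cast_le.2 (mem_Icc.1 hd).2).trans hNx
    _ = (C * x ^ δ) * ∑ d ∈ Icc 1 N with d ∈ Icc 1 ⌊x ^ B⌋₊, 2 := by
        rw [← Finset.mul_sum, Finset.sum_filter]
    _ ≤ (C * x ^ δ) * (x ^ B * 2) := by
        gcongr
        rw [Finset.sum_const, nsmul_eq_mul]
        gcongr
        refine le_trans ?_ (Nat.floor_le (by positivity : 0 ≤ x ^ B))
        refine Nat.cast_le.2 ?_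
        calc _ ≤ #(Icc 1 ⌊x ^ B⌋₊) := Finset.card_le_card fun d hd => (Finset.mem_filter.1 hd).2
          _ = _ := by simp
    _ = 2 * C * (x ^ (1 - δ) / x ^ α) := by
        rw [← Real.rpow_sub hx0]
        have : 1 - δ - α = δ + B := by rw [hδ]; ring
        rw [this, Real.rpow_add hx0]; ring
    _ ≤ _ := by gcongr

/-- The solutions of `a * b ≡ r (mod q)` form a residue class modulo `q / gcd(b, q)`, or there
are none, according to the greatest common divisor of the class with `q`. -/
theorem mul_modEq_classes {q b g r r' : ℕ} (hq : 1 ≤ q) (hr : r.gcd q = g) (hr' : r'.gcd q = g) :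
    ((∀ a, ¬ a * b ≡ r [MOD q]) ∧ ∀ a, ¬ a * b ≡ r' [MOD q]) ∨
    ∃ q' v v' : ℕ, 1 ≤ q' ∧ q' ≤ q ∧ q ≤ q' * g ∧ v.gcd q' ∣ g ∧ v'.gcd q' = v.gcd q' ∧
      (∀ a, a * b ≡ r [MOD q] ↔ a ≡ v [MOD q']) ∧ ∀ a, a * b ≡ r' [MOD q] ↔ a ≡ v' [MOD q'] := by
  set e := b.gcd q with he
  have he0 : 0 < e := Nat.gcd_pos_of_pos_right _ hq
  have heq : e ∣ q := Nat.gcd_dvd_right _ _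
  have hqe : q / e * e = q := Nat.div_mul_cancel heq
  have hq'0 : 1 ≤ q / e := Nat.div_pos (Nat.le_of_dvd hq heq) he0
  have hg0 : 0 < g := hr ▸ Nat.gcd_pos_of_pos_right _ hq
  have key : ∀ r, r.gcd q = g → e ∣ g → ∃ v, v.gcd (q / e) = g / e ∧
      ∀ a, a * b ≡ r [MOD q] ↔ a ≡ v [MOD q / e] := by
    intro r hr heg
    have her : e ∣ r := heg.trans (hr ▸ Nat.gcd_dvd_left _ _)
    obtain ⟨s, rfl⟩ := her
    -- Bézout: `m` inverts `b` up to the gcd `e`, and `m * s` then solves the congruence for `r = e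
    -- * s`.
    have hsol : ∃ m, b * m ≡ e [MOD q] := by
      rcases lt_or_ge e q with h | h
      · obtain ⟨m, -, hm⟩ := Nat.exists_mul_mod_eq_gcd (n := b) (k := q) h
        refine ⟨m, ?_⟩
        rw [Nat.ModEq, hm, Nat.mod_eq_of_lt h]
      · have : e = q := le_antisymm (Nat.le_of_dvd hq heq) h
        refine ⟨0, ?_⟩
        rw [mul_zero, this]
        exact ((Nat.modEq_zero_iff_dvd).2 dvd_rfl).symm
    obtain ⟨m, hm⟩ := hsol
    have hv : (m * s) * b ≡ e * s [MOD q] := by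
      have := hm.mul_right s
      rwa [show m * s * b = b * m * s by ring]
    refine ⟨m * s, ?_, fun a => ?_⟩
    · have h1 : ((m * s) * b).gcd q = g := by rw [hv.gcd_eq, hr]
      have hb : b / e * e = b := Nat.div_mul_cancel (Nat.gcd_dvd_left _ _)
      have hco : (q / e).Coprime (b / e) := (Nat.coprime_div_gcd_div_gcd he0).symm
      have h2 : ((m * s) * b).gcd q = ((m * s) * (b / e)).gcd (q / e) * e := by
        rw [← Nat.gcd_mul_right, hqe, mul_assoc (m * s), hb]
      have h3 : ((m * s) * (b / e)).gcd (q / e) = (m * s).gcd (q / e) :=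
        Nat.Coprime.gcd_mul_right_cancel _ hco.symm
      rw [h2, h3] at h1
      rw [← h1, Nat.mul_div_cancel _ he0]
    · constructor
      · intro h
        have := (h.trans hv.symm).cancel_right_div_gcd hq
        rwa [Nat.gcd_comm] at this
      · intro h
        have h1 : a * e ≡ m * s * e [MOD q] := by
          have := h.mul_right' e
          rwa [hqe] at this
        have h2 := h1.mul_left (b / e)
        have hb : b / e * e = b := Nat.div_mul_cancel (Nat.gcd_dvd_left _ _)
        rw [show b / e * (a * e) = a * (b / e * e) by ring,
          show b / e * (m * s * e) = m * s * (b / e * e) by ring, hb] at h2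
        exact h2.trans hv
  by_cases heg : e ∣ g
  · obtain ⟨v, hv1, hv2⟩ := key r hr heg
    obtain ⟨v', hv1', hv2'⟩ := key r' hr' heg
    refine Or.inr ⟨q / e, v, v', hq'0, Nat.div_le_self _ _, ?_, ?_, hv1'.trans hv1.symm, hv2, hv2'⟩
    · calc q = q / e * e := hqe.symm
        _ ≤ _ := by gcongr; exact Nat.le_of_dvd hg0 heg
    · rw [hv1]; exact Nat.div_dvd_of_dvd heg
  · have : ∀ r, r.gcd q = g → ∀ a, ¬ a * b ≡ r [MOD q] := by
      intro r hr a ha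
      refine heg ?_
      rw [← hr]
      refine Nat.dvd_gcd ?_ heq
      have h1 : e ∣ a * b := (Nat.gcd_dvd_left b q).mul_left a
      exact ((ha.of_dvd heq).dvd_iff dvd_rfl).1 h1
    exact Or.inl ⟨this r hr, this r' hr'⟩

/-- The sum of `F a` over `1 ≤ a ≤ y` with `a * b ≡ r (mod q)`. -/
noncomputable def sumMulClass (F : ℕ → ℝ) (q b r : ℕ) (y : ℝ) : ℝ :=
  ∑ a ∈ Icc 1 ⌊y⌋₊ with a * b ≡ r [MOD q], F a

theorem abs_sub_le_max_of_nonneg {a b c : ℝ} (ha : 0 ≤ a) (hb : 0 ≤ b) (hac : a ≤ c) (hbc : b ≤ c) :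
    |a - b| ≤ c := by
  rw [abs_le]; constructor <;> linarith

/-- The congruence in `a` has modulus `q' = q / gcd(b,q)`, with `q ≤ q' g` when soluble, so passing
to `q'` costs only a factor `g`. The second, trivial bound serves ranges `y` too short for the
modulus. -/
theorem Equidistributed.sumMulClass_dk {j : ℕ} {γ : ℝ}
    (hF : Equidistributed (fun n => (dk j n : ℝ)) γ) {g : ℕ} (hg : 1 ≤ g) {η : ℝ} (hη : 0 < η) :
    ∃ δ : ℝ, 0 < δ ∧ δ ≤ 1 ∧ ∃ C : ℝ, 0 ≤ C ∧ ∀ q b r r' : ℕ, 1 ≤ q → r.gcd q = g → r'.gcd q = g →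
      ∀ y : ℝ, 1 ≤ y →
        ((q : ℝ) ≤ y ^ γ → |sumMulClass (fun n => (dk j n : ℝ)) q b r y -
          sumMulClass (fun n => (dk j n : ℝ)) q b r' y| ≤ C * (y ^ (1 - δ) / q)) ∧
        |sumMulClass (fun n => (dk j n : ℝ)) q b r y -
          sumMulClass (fun n => (dk j n : ℝ)) q b r' y| ≤ C * (y ^ η * (y / q + 1)) := by
  obtain ⟨δ, hδ, hδ1, C₁, hC₁, H₁⟩ := hF.exists_uniform hg
  obtain ⟨C₂, hC₂, H₂⟩ := exists_dk_le_rpow j hη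
  have hg1 : (1 : ℝ) ≤ g := by exact_mod_cast hg
  refine ⟨δ, hδ, hδ1, C₁ * g + C₂ * g, by positivity, fun q b r r' hq hr hr' y hy => ?_⟩
  have hy0 : 0 < y := by linarith
  have hq0 : (0 : ℝ) < q := by exact_mod_cast hq
  rcases mul_modEq_classes (b := b) hq hr hr' with ⟨h1, h2⟩ |
    ⟨q', v, v', hq', hq'q, hqg, hv, hv', h1, h2⟩
  · simp only [sumMulClass, h1, h2, Finset.filter_false, Finset.sum_empty, sub_zero, abs_zero]
    exact ⟨fun _ => by positivity, by positivity⟩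
  have hq'0 : (0 : ℝ) < q' := by exact_mod_cast hq'
  have hinv : (1 : ℝ) / q' ≤ g / q := by
    rw [div_le_div_iff₀ hq'0 hq0, one_mul, mul_comm]
    exact_mod_cast hqg
  constructor
  · intro hqy
    have hqy' : (q' : ℝ) ≤ y ^ γ := (Nat.cast_le.2 hq'q).trans hqy
    have h := H₁ y hy q' v v' hq' hqy' hv hv'
    simp only [sumMulClass, h1, h2]
    refine h.trans ?_
    calc C₁ * (y ^ (1 - δ) / q') = C₁ * y ^ (1 - δ) * (1 / q') := by ring
      _ ≤ C₁ * y ^ (1 - δ) * (g / q) := by gcongr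
      _ = C₁ * g * (y ^ (1 - δ) / q) := by ring
      _ ≤ _ := by gcongr; exact le_add_of_nonneg_right (by positivity)
  · have hone : ∀ v : ℕ, ∑ a ∈ Icc 1 ⌊y⌋₊ with a ≡ v [MOD q'], (dk j a : ℝ) ≤
        (C₁ * g + C₂ * g) * (y ^ η * (y / q + 1)) := by
      intro v
      have hcard := (card_Ioc_modEq_bounds hq' (Nat.zero_le ⌊y⌋₊) v).2
      have hIoc : Ioc 0 ⌊y⌋₊ = Icc 1 ⌊y⌋₊ := by ext; simp [Nat.succ_le_iff]
      rw [hIoc] at hcard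
      have hfy := Nat.floor_le hy0.le
      calc _ ≤ ∑ a ∈ Icc 1 ⌊y⌋₊ with a ≡ v [MOD q'], C₂ * y ^ η := by
            refine Finset.sum_le_sum fun a ha => ?_
            obtain ⟨ha1, ha2⟩ := cast_mem_Icc_floor (Finset.mem_filter.1 ha).1
            refine (H₂ a (by rintro rfl; norm_num at ha1)).trans ?_
            gcongr
        _ = #{a ∈ Icc 1 ⌊y⌋₊ | a ≡ v [MOD q']} * (C₂ * y ^ η) := by
            rw [Finset.sum_const, nsmul_eq_mul]
        _ ≤ (y * (1 / q') + 1) * (C₂ * y ^ η) := by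
            gcongr
            refine hcard.trans ?_
            rw [mul_one_div, Nat.cast_zero, sub_zero]
            gcongr
        _ ≤ (y * (g / q) + g) * (C₂ * y ^ η) := by gcongr
        _ = C₂ * g * (y ^ η * (y / q + 1)) := by ring
        _ ≤ _ := by gcongr; exact le_add_of_nonneg_left (by positivity)
    simp only [sumMulClass, h1, h2]
    exact abs_sub_le_max_of_nonneg (Finset.sum_nonneg fun _ _ => by positivity)
      (Finset.sum_nonneg fun _ _ => by positivity) (hone v) (hone v')

/-- For `n = a b`, this solves the condition `a > n^A` for `a`, turning it into a lower cutoff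
depending on `b` alone. -/
theorem rpow_lt_iff_not_le_mul_rpow {A a b : ℝ} (hA1 : A < 1) (ha : 0 < a) (hb : 0 < b) :
    ¬ a ≤ (b * a) ^ A ↔ b ^ (A / (1 - A)) < a := by
  have h1 : 0 < 1 - A := by linarith
  have h2 : a = a ^ (1 - A) * a ^ A := by rw [← Real.rpow_add ha]; simp
  rw [not_le, Real.mul_rpow hb.le ha.le, div_eq_mul_inv, Real.rpow_mul hb.le,
    Real.rpow_inv_lt_iff_of_pos (by positivity) ha.le h1]
  constructor
  · intro h
    exact lt_of_mul_lt_mul_right (h.trans_eq h2) (by positivity)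
  · intro h
    calc b ^ A * a ^ A < a ^ (1 - A) * a ^ A := by gcongr
      _ = a := h2.symm

/-- The part of `d_{j+1}(n)` that is missing from `partialDk (j + 1) n A`. -/
noncomputable def remainderDk (j n : ℕ) (A : ℝ) : ℕ :=
  ∑ a ∈ n.divisors.filter (fun a : ℕ => ¬ (a : ℝ) ≤ (n : ℝ) ^ A), dk j a

theorem partialDk_add_remainderDk (j n : ℕ) (A : ℝ) :
    partialDk (j + 1) n A + remainderDk j n A = dk (j + 1) n := by
  rw [partialDk, remainderDk, dk_succ, Nat.add_sub_cancel]
  exact Finset.sum_filter_add_sum_filter_not _ _ _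

theorem sumClass_remainderDk (j q r : ℕ) {A x : ℝ} (hA1 : A < 1) :
    sumClass (fun n => (remainderDk j n A : ℝ)) q r x =
      ∑ b ∈ Icc 1 ⌊x⌋₊, ∑ a ∈ Icc 1 ⌊x / b⌋₊ with
        a * b ≡ r [MOD q] ∧ (b : ℝ) ^ (A / (1 - A)) < a, (dk j a : ℝ) := by
  calc _ = ∑ n ∈ Icc 1 ⌊x⌋₊, ∑ a ∈ n.divisors,
        if n ≡ r [MOD q] ∧ ¬ (a : ℝ) ≤ (n : ℝ) ^ A then (dk j a : ℝ) else 0 := by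
        rw [sumClass, Finset.sum_filter]
        refine Finset.sum_congr rfl fun n _ => ?_
        split_ifs with h
        · simp only [remainderDk, h, true_and, ← Finset.sum_filter]
          push_cast
          rfl
        · simp [h]
    _ = ∑ n ∈ Icc 1 ⌊x⌋₊, ∑ b ∈ n.divisors,
        if n ≡ r [MOD q] ∧ ¬ ((n / b : ℕ) : ℝ) ≤ (n : ℝ) ^ A then (dk j (n / b) : ℝ) else 0 := by
        refine Finset.sum_congr rfl fun n _ => ?_
        exact (Nat.sum_div_divisors n (fun a =>
          if n ≡ r [MOD q] ∧ ¬ (a : ℝ) ≤ (n : ℝ) ^ A then (dk j a : ℝ) else 0)).symm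
    _ = _ := by
        rw [sum_Icc_sum_divisors _ (fun b n =>
          if n ≡ r [MOD q] ∧ ¬ ((n / b : ℕ) : ℝ) ≤ (n : ℝ) ^ A then (dk j (n / b) : ℝ) else 0)]
        refine Finset.sum_congr rfl fun b hb => ?_
        have hb1 : 0 < b := (mem_Icc.1 hb).1
        rw [floor_div_natCast', Finset.sum_filter]
        refine Finset.sum_congr rfl fun a ha => ?_
        have ha1 : 0 < a := (mem_Icc.1 ha).1
        have := rpow_lt_iff_not_le_mul_rpow hA1 (a := (a : ℝ)) (b := (b : ℝ))
          (by exact_mod_cast ha1) (by exact_mod_cast hb1)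
        rw [Nat.mul_div_cancel_left _ hb1]
        refine if_congr ?_ rfl rfl
        rw [← this, mul_comm b a, Nat.cast_mul, mul_comm (b : ℝ) a]

theorem sum_filter_lt_eq_sumMulClass_sub (F : ℕ → ℝ) (q b r : ℕ) {t y : ℝ} (ht : t ≤ y) (ht0 : 0 ≤ t) :
    ∑ a ∈ Icc 1 ⌊y⌋₊ with a * b ≡ r [MOD q] ∧ t < a, F a =
      sumMulClass F q b r y - sumMulClass F q b r t := by
  rw [eq_sub_iff_add_eq, sumMulClass, sumMulClass]
  rw [← Finset.sum_filter_add_sum_filter_not {a ∈ Icc 1 ⌊y⌋₊ | a * b ≡ r [MOD q]}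
    (fun a : ℕ => t < a), Finset.filter_filter, Finset.filter_filter]
  congr 2
  ext a
  simp only [mem_filter, mem_Icc, not_lt, ← Nat.le_floor_iff ht0]
  have := Nat.floor_le_floor ht
  constructor
  · rintro ⟨⟨h1, h2⟩, h3⟩
    exact ⟨⟨h1, h2.trans this⟩, h3, h2⟩
  · rintro ⟨⟨h1, h2⟩, h3, h4⟩
    exact ⟨⟨h1, h4⟩, h3⟩

/-- Write `n = a b` with `a > n^A`. For fixed `b`, necessarily `b ≤ x^(1-A)`, and `a` runs over an
interval from `t = b^(A/(1-A))` to `x/b ≥ x^A`. As `q ≤ x^α ≤ (x^A)^γ`, the sum up to `x/b` is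
equidistributed; the sum up to `t` is either equidistributed as well or so short that the trivial
bound suffices. -/
theorem equidistributed_remainderDk {j : ℕ} {A α γ : ℝ} (hA : 0 < A) (hA1 : A < 1) (hα : 0 < α)
    (hαγ : α < A * γ) (hγ1 : γ ≤ 1) (hF : Equidistributed (fun n => (dk j n : ℝ)) γ) :
    Equidistributed (fun n => (remainderDk j n A : ℝ)) α := by
  intro g hg
  have hγ : 0 < γ := by
    by_contra h
    nlinarith
  -- If `q > t^γ` then `t ≤ x^κ`, with `κ < A`. The trivial bound over `b ≤ x^(1-A)` is of size
  -- `x^(1-A+η+κ)/q`, and `η = (A-κ)/2` makes this exactly `x^(1-η)/q`.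
  set κ := α / γ with hκ
  have hκA : κ < A := by rw [hκ, div_lt_iff₀ hγ]; exact hαγ
  have hακ : α ≤ κ := by rw [hκ, le_div_iff₀ hγ]; nlinarith
  have hκ0 : 0 < κ := by positivity
  set η := (A - κ) / 2 with hη
  have hη0 : 0 < η := by rw [hη]; linarith
  obtain ⟨δ, hδ, hδ1, C, hC, H⟩ := hF.sumMulClass_dk hg hη0
  obtain ⟨C', hC', H'⟩ := exists_one_add_log_le_rpow (η := A * δ / 2) (by positivity)
  refine ⟨min (A * δ / 2) η, lt_min (by positivity) hη0, 2 * C * C' + 2 * C, by positivity,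
    fun x hx q r r' hq hqx hr hr' => ?_⟩
  have hx0 : 0 < x := by linarith
  have hq0 : (0 : ℝ) < q := by exact_mod_cast hq
  rw [sumClass_remainderDk j q r hA1, sumClass_remainderDk j q r' hA1, ← Finset.sum_sub_distrib]
  set Y := x ^ (1 - A) with hY
  have hYx : Y ≤ x := by
    calc Y ≤ x ^ (1 : ℝ) := Real.rpow_le_rpow_of_exponent_le hx (by linarith)
      _ = x := Real.rpow_one x
  set E : ℕ → ℝ := fun b => 2 * C * ((x / b) * x ^ (-(A * δ)) / q) + C * (x ^ η * (x ^ κ / q + 1))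
    with hE
  have hE0 : ∀ b, 0 ≤ E b := fun b => by positivity
  have hterm : ∀ b ∈ Icc 1 ⌊x⌋₊,
      |∑ a ∈ Icc 1 ⌊x / b⌋₊ with a * b ≡ r [MOD q] ∧ (b : ℝ) ^ (A / (1 - A)) < a, (dk j a : ℝ) -
        ∑ a ∈ Icc 1 ⌊x / b⌋₊ with a * b ≡ r' [MOD q] ∧ (b : ℝ) ^ (A / (1 - A)) < a, (dk j a : ℝ)| ≤
        if b ∈ Icc 1 ⌊Y⌋₊ then E b else 0 := by
    intro b hb
    obtain ⟨hb1, hbx⟩ := cast_mem_Icc_floor hb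
    have hb0 : (0 : ℝ) < b := by linarith
    set t := (b : ℝ) ^ (A / (1 - A)) with ht
    have ht1 : 1 ≤ t := Real.one_le_rpow hb1 (div_nonneg hA.le (by linarith))
    rcases lt_or_ge t (x / b) with htx | htx
    · have hbY : (b : ℝ) ≤ Y := by
        have h1 : t * b < x := by rwa [lt_div_iff₀ hb0] at htx
        have h2 : t * b = (b : ℝ) ^ (1 / (1 - A)) := by
          rw [ht]
          nth_rewrite 2 [← Real.rpow_one (b : ℝ)]
          rw [← Real.rpow_add hb0]
          congr 1
          have : 1 - A ≠ 0 := by linarith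
          field_simp
          ring
        rw [h2, one_div] at h1
        exact ((Real.rpow_inv_lt_iff_of_pos hb0.le hx0.le (by linarith)).1 h1).le
      have hbmem : b ∈ Icc 1 ⌊Y⌋₊ := mem_Icc.2 ⟨(mem_Icc.1 hb).1, Nat.le_floor hbY⟩
      rw [if_pos hbmem, sum_filter_lt_eq_sumMulClass_sub _ _ _ _ htx.le (by linarith),
        sum_filter_lt_eq_sumMulClass_sub _ _ _ _ htx.le (by linarith)]
      have hxb : x ^ A ≤ x / b := by
        rw [le_div_iff₀ hb0]
        calc x ^ A * b ≤ x ^ A * x ^ (1 - A) := by gcongr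
          _ = x := by rw [← Real.rpow_add hx0]; simp
      have hxb1 : 1 ≤ x / b := (Real.one_le_rpow hx hA.le).trans hxb
      have hxb0 : 0 < x / b := by linarith
      have hsave : (x / b) ^ (1 - δ) ≤ (x / b) * x ^ (-(A * δ)) := by
        rw [sub_eq_add_neg, Real.rpow_add hxb0, Real.rpow_one]
        gcongr
        calc (x / b) ^ (-δ) ≤ (x ^ A) ^ (-δ) :=
              Real.rpow_le_rpow_of_nonpos (by positivity) hxb (by linarith)
          _ = _ := by rw [← Real.rpow_mul hx0.le]; ring_nf
      have hmain : |sumMulClass (fun n => (dk j n : ℝ)) q b r (x / b) -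
          sumMulClass (fun n => (dk j n : ℝ)) q b r' (x / b)| ≤
          C * ((x / b) * x ^ (-(A * δ)) / q) := by
        refine ((H q b r r' hq hr hr' (x / b) hxb1).1 ?_).trans (by gcongr)
        calc (q : ℝ) ≤ x ^ α := hqx
          _ ≤ x ^ (A * γ) := Real.rpow_le_rpow_of_exponent_le hx hαγ.le
          _ = (x ^ A) ^ γ := Real.rpow_mul hx0.le _ _
          _ ≤ _ := by gcongr
      have hlow : |sumMulClass (fun n => (dk j n : ℝ)) q b r t -
          sumMulClass (fun n => (dk j n : ℝ)) q b r' t| ≤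
          C * ((x / b) * x ^ (-(A * δ)) / q) + C * (x ^ η * (x ^ κ / q + 1)) := by
        rcases le_or_gt (q : ℝ) (t ^ γ) with h | h
        · refine ((H q b r r' hq hr hr' t ht1).1 h).trans ?_
          have h1 : t ^ (1 - δ) ≤ (x / b) * x ^ (-(A * δ)) :=
            (Real.rpow_le_rpow (by linarith) htx.le (by linarith)).trans hsave
          have h2 : 0 ≤ C * (x ^ η * (x ^ κ / q + 1)) := by positivity
          have h3 : C * (t ^ (1 - δ) / q) ≤ C * ((x / b) * x ^ (-(A * δ)) / q) := by gcongr
          linarith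
        · refine ((H q b r r' hq hr hr' t ht1).2).trans ?_
          have h1 : t ≤ x ^ κ := by
            rw [hκ, div_eq_mul_inv, Real.rpow_mul hx0.le,
              Real.le_rpow_inv_iff_of_pos (by linarith) (by positivity) hγ]
            exact (h.trans_le hqx).le
          have h2 : t ≤ x := htx.le.trans (div_le_self hx0.le hb1)
          have h3 : 0 ≤ C * ((x / b) * x ^ (-(A * δ)) / q) := by positivity
          have h4 : C * (t ^ η * (t / q + 1)) ≤ C * (x ^ η * (x ^ κ / q + 1)) := by gcongr
          linarith
      have hcomb : ∀ u v u' v' : ℝ, u - v - (u' - v') = (u - u') - (v - v') := by intros; ring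
      rw [hcomb]
      refine (abs_sub _ _).trans ((add_le_add hmain hlow).trans (le_of_eq ?_))
      rw [hE]; ring
    · have hempty : ∀ r, {a ∈ Icc 1 ⌊x / b⌋₊ | a * b ≡ r [MOD q] ∧ t < (a : ℝ)} = ∅ := by
        intro r
        refine Finset.filter_eq_empty_iff.2 fun a ha h => ?_
        exact absurd (cast_mem_Icc_floor ha).2 (not_le.2 (htx.trans_lt h.2))
      rw [hempty, hempty]
      simp only [Finset.sum_empty, sub_zero, abs_zero]
      split_ifs
      · exact hE0 b
      · rfl
  set δ' := min (A * δ / 2) η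
  have hY1 : 1 ≤ Y := Real.one_le_rpow hx (by linarith)
  calc _ ≤ ∑ b ∈ Icc 1 ⌊x⌋₊, (if b ∈ Icc 1 ⌊Y⌋₊ then E b else 0) :=
        (Finset.abs_sum_le_sum_abs _ _).trans (Finset.sum_le_sum hterm)
    _ = ∑ b ∈ Icc 1 ⌊Y⌋₊, E b := by
        rw [← Finset.sum_filter]
        refine Finset.sum_congr ?_ fun _ _ => rfl
        ext b
        simp only [mem_filter, mem_Icc]
        have := Nat.floor_le_floor hYx
        constructor
        · exact fun h => h.2
        · exact fun h => ⟨⟨h.1, h.2.trans this⟩, h⟩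
    _ = 2 * C * (x ^ (1 - A * δ) / q) * ∑ b ∈ Icc 1 ⌊Y⌋₊, (1 : ℝ) / b +
          ⌊Y⌋₊ * (C * (x ^ η * (x ^ κ / q + 1))) := by
        rw [hE, Finset.sum_add_distrib, Finset.sum_const, nsmul_eq_mul, Nat.card_Icc,
          Nat.add_sub_cancel, Finset.mul_sum]
        congr 1
        refine Finset.sum_congr rfl fun b _ => ?_
        rw [sub_eq_add_neg, Real.rpow_add hx0, Real.rpow_one]
        ring
    _ ≤ 2 * C * (x ^ (1 - A * δ) / q) * (C' * x ^ (A * δ / 2)) +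
          Y * (C * (x ^ η * (x ^ κ / q + x ^ κ / q))) := by
        gcongr
        · refine (sum_inv_le_one_add_log hY1).trans ?_
          refine le_trans ?_ (H' x hx)
          gcongr
        · exact Nat.floor_le (by linarith)
        · rw [le_div_iff₀ hq0, one_mul]
          exact hqx.trans (Real.rpow_le_rpow_of_exponent_le hx hακ)
    _ = 2 * C * C' * (x ^ (1 - A * δ / 2) / q) + 2 * C * (x ^ (1 - η) / q) := by
        have h1 : x ^ (1 - A * δ / 2) = x ^ (1 - A * δ) * x ^ (A * δ / 2) := by
          rw [← Real.rpow_add hx0]; ring_nf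
        have h2 : x ^ (1 - η) = Y * x ^ η * x ^ κ := by
          rw [hY, ← Real.rpow_add hx0, ← Real.rpow_add hx0]
          congr 1
          rw [hη]; ring
        rw [h1, h2]; ring
    _ ≤ 2 * C * C' * (x ^ (1 - δ') / q) + 2 * C * (x ^ (1 - δ') / q) := by
        gcongr ?_ * (?_ / _) + _ * (?_ / _)
        · exact rpow_one_sub_le hx (min_le_left _ _)
        · exact rpow_one_sub_le hx (min_le_right _ _)
    _ = _ := by ring

theorem equidistributed_partialDk {j : ℕ} {A α θ₀ θ₁ : ℝ} (hA : 0 < A) (hA1 : A < 1) (hα : 0 < α)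
    (hθ₁ : ∀ g : ℕ, 1 ≤ g → IsExponentOfDistribution g (j + 1) θ₁)
    (hθ₀ : ∀ g : ℕ, 1 ≤ g → IsExponentOfDistribution g j θ₀) (hα₁ : α < θ₁) (hα₀ : α < A * θ₀) :
    Equidistributed (fun n => (partialDk (j + 1) n A : ℝ)) α := by
  have h1 : α / A < θ₀ := by rwa [div_lt_iff₀ hA, mul_comm]
  -- A level `γ` for `dk j` strictly below `θ₀` and still satisfying `α < A γ`.
  obtain ⟨γ, hγ1, hγ2⟩ := exists_between h1
  have h2 : α < A * γ := by rwa [div_lt_iff₀ hA, mul_comm] at hγ1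
  have h3 := (equidistributed_dk hθ₁ hα₁).sub (equidistributed_remainderDk hA hA1 hα h2
    (hγ2.le.trans (hθ₀ 1 le_rfl).2.1) (equidistributed_dk hθ₀ hγ2))
  convert h3 using 2 with n
  rw [← partialDk_add_remainderDk j n A]
  push_cast
  ring

/-! ### From sums over multiples to sums over single residue classes. -/

theorem sum_divisors_moebius (n : ℕ) :
    ∑ e ∈ n.divisors, (ArithmeticFunction.moebius e : ℝ) = if n = 1 then 1 else 0 := by
  have h := congrArg (fun f => (f n : ℤ)) ArithmeticFunction.moebius_mul_coe_zeta
  simp only [ArithmeticFunction.coe_mul_zeta_apply, ArithmeticFunction.one_apply] at h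
  have h' := congrArg (Int.cast (R := ℝ)) h
  push_cast at h'
  exact h'

/-- Möbius inversion for the condition `gcd(n, q) = g`. -/
theorem sum_gcd_eq_sum_moebius (F : ℕ → ℝ) (N : ℕ) {q g : ℕ} (hq : 1 ≤ q) (hg : g ∣ q) :
    ∑ n ∈ Icc 1 N with n.gcd q = g, F n =
      ∑ e ∈ (q / g).divisors, (ArithmeticFunction.moebius e : ℝ) *
        ∑ n ∈ Icc 1 N with g * e ∣ n, F n := by
  have hg0 : 0 < g := Nat.pos_of_dvd_of_pos hg hq
  have hq0 : 0 < q / g := Nat.div_pos (Nat.le_of_dvd hq hg) hg0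
  simp only [Finset.sum_filter, Finset.mul_sum]
  rw [Finset.sum_comm]
  refine Finset.sum_congr rfl fun n hn => ?_
  by_cases hgn : g ∣ n
  · obtain ⟨m, rfl⟩ := hgn
    have hqg : q = g * (q / g) := (Nat.mul_div_cancel' hg).symm
    have h1 : (g * m).gcd q = g ↔ m.gcd (q / g) = 1 := by
      conv_lhs => rw [hqg, Nat.gcd_mul_left]
      exact Nat.mul_eq_left hg0.ne'
    have h2 : ∀ e, g * e ∣ g * m ↔ e ∣ m := fun e => Nat.mul_dvd_mul_iff_left hg0
    simp only [h1, h2, mul_ite, mul_zero]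
    have h3 : (q / g).divisors.filter (fun e => e ∣ m) = (m.gcd (q / g)).divisors := by
      ext e
      simp only [mem_filter, Nat.mem_divisors, Nat.dvd_gcd_iff, ne_eq, Nat.gcd_eq_zero_iff]
      have := hq0.ne'
      tauto
    rw [← Finset.sum_filter, h3, ← Finset.sum_mul, sum_divisors_moebius]
    split_ifs <;> simp
  · have h1 : n.gcd q ≠ g := fun h => hgn (h ▸ Nat.gcd_dvd_left _ _)
    have h2 : ∀ e, ¬ g * e ∣ n := fun e h => hgn ((dvd_mul_right _ _).trans h)
    simp [h1, h2]

theorem sum_sumClass_eq (F : ℕ → ℝ) {q g : ℕ} (hq : 1 ≤ q) (x : ℝ) :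
    ∑ s ∈ range q with q.gcd s = g, sumClass F q s x =
      ∑ n ∈ Icc 1 ⌊x⌋₊ with n.gcd q = g, F n := by
  simp only [sumClass]
  rw [Finset.sum_comm' (t' := {n ∈ Icc 1 ⌊x⌋₊ | n.gcd q = g}) (s' := fun n => {n % q})]
  · simp
  · intro s n
    simp only [mem_filter, mem_range, mem_singleton]
    constructor
    · rintro ⟨⟨h1, h2⟩, h3, h4⟩
      refine ⟨?_, h3, ?_⟩
      · rw [h4, Nat.mod_eq_of_lt h1]
      · rw [h4.gcd_eq, Nat.gcd_comm]; exact h2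
    · rintro ⟨rfl, h1, h2⟩
      refine ⟨⟨Nat.mod_lt _ hq, ?_⟩, h1, (Nat.mod_modEq n q).symm⟩
      rw [Nat.gcd_comm, (Nat.mod_modEq n q).gcd_eq]; exact h2

/-- A bound for the sums of `F` over multiples, with a saving in the modulus. -/
def SmallOnMultiples (F : ℕ → ℝ) (m : ℕ) : Prop :=
  ∃ C : ℝ, 0 ≤ C ∧ ∀ N D : ℕ, 1 ≤ N → 1 ≤ D → |∑ n ∈ Icc 1 N with D ∣ n, F n| ≤
    C * (N * (D : ℝ) ^ (-(3 / 4) : ℝ) * (1 + Real.log N) ^ m)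

/-- By equidistribution the class sum is close to its mean over the `φ(q/g)` classes of the same gcd
`g`. Their total is the sum over `gcd(n,q) = g`, which Möbius inversion reduces to multiples. One
`divisorWeight` comes from the Möbius sum and one from `1/φ(q/g)`, hence the square. -/
theorem Equidistributed.abs_sumClass_le {F : ℕ → ℝ} {α : ℝ} (hF : Equidistributed F α) {m : ℕ}
    (hcore : SmallOnMultiples F m) {h : ℕ} (hh : 1 ≤ h) : ∃ C : ℝ, 0 ≤ C ∧ ∀ N q r : ℕ, 1 ≤ N →
      1 ≤ q → r.gcd q ∣ h → (q : ℝ) ≤ (N : ℝ) ^ α →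
        |sumClass F q r N| ≤ C * (N * (1 + Real.log N) ^ m * (divisorWeight q ^ 2 / q)) := by
  obtain ⟨δ, hδ, hδ1, C₁, hC₁, H₁⟩ := hF.exists_uniform hh
  obtain ⟨C₂, hC₂, H₂⟩ := hcore
  refine ⟨C₁ + 32 * h * C₂, by positivity, fun N q r hN hq hr hqN => ?_⟩
  set g := r.gcd q with hg
  have hN1 : (1 : ℝ) ≤ N := by exact_mod_cast hN
  have hN0 : (0 : ℝ) < N := by linarith
  have hq0 : (0 : ℝ) < q := by exact_mod_cast hq
  have hgq : g ∣ q := Nat.gcd_dvd_right _ _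
  have hg0 : 0 < g := Nat.pos_of_dvd_of_pos hgq hq
  have hg0' : (0 : ℝ) < g := by exact_mod_cast hg0
  have hgh : (g : ℝ) ≤ h := by exact_mod_cast Nat.le_of_dvd hh hr
  have hqg0 : 0 < q / g := Nat.div_pos (Nat.le_of_dvd hq hgq) hg0
  have hφ : (0 : ℝ) < (q / g).totient := by exact_mod_cast Nat.totient_pos.2 hqg0
  set W := divisorWeight q with hW
  have hW1 : 1 ≤ W := one_le_divisorWeight (by omega)
  set Λ := (1 + Real.log N) ^ m with hΛ
  have hΛ1 : 1 ≤ Λ := one_le_pow₀ (by linarith [Real.log_nonneg hN1])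
  set T := ∑ n ∈ Icc 1 N with n.gcd q = g, F n with hT
  have hTle : |T| ≤ C₂ * (N * Λ) * W := by
    rw [hT, sum_gcd_eq_sum_moebius F N hq hgq]
    calc _ ≤ ∑ e ∈ (q / g).divisors, C₂ * (N * Λ) * (e : ℝ) ^ (-(3 / 4) : ℝ) := by
          refine (Finset.abs_sum_le_sum_abs _ _).trans (Finset.sum_le_sum fun e he => ?_)
          have he1 : 1 ≤ e := Nat.pos_of_mem_divisors he
          have he0 : (0 : ℝ) < e := by exact_mod_cast he1
          rw [abs_mul]
          have hmu : |(ArithmeticFunction.moebius e : ℝ)| ≤ 1 := by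
            exact_mod_cast ArithmeticFunction.abs_moebius_le_one (n := e)
          calc _ ≤ 1 * (C₂ * (N * ((g * e : ℕ) : ℝ) ^ (-(3 / 4) : ℝ) * Λ)) :=
                mul_le_mul hmu (H₂ N (g * e) hN (Nat.mul_pos hg0 he1)) (abs_nonneg _) zero_le_one
            _ ≤ 1 * (C₂ * (N * (e : ℝ) ^ (-(3 / 4) : ℝ) * Λ)) := by
                gcongr 1 * (_ * (_ * ?_ * _))
                refine Real.rpow_le_rpow_of_nonpos he0 ?_ (by norm_num)
                exact_mod_cast Nat.le_mul_of_pos_left e hg0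
            _ = _ := by ring
      _ = C₂ * (N * Λ) * divisorWeight (q / g) := by rw [← Finset.mul_sum, divisorWeight]
      _ ≤ _ := by
          gcongr
          exact divisorWeight_mono (by omega) (Nat.div_dvd_of_dvd hgq)
  have havg : |((q / g).totient : ℝ) * sumClass F q r N - T| ≤
      (q / g).totient * (C₁ * ((N : ℝ) ^ (1 - δ) / q)) := by
    have hcard := Nat.totient_div_of_dvd hgq
    have hsum := sum_sumClass_eq F (g := g) hq (N : ℝ)
    rw [Nat.floor_natCast, ← hT] at hsum
    rw [← hsum, hcard, ← nsmul_eq_mul, ← nsmul_eq_mul, ← Finset.sum_const, ← Finset.sum_const,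
      ← Finset.sum_sub_distrib]
    refine (Finset.abs_sum_le_sum_abs _ _).trans (Finset.sum_le_sum fun s hs => ?_)
    have hs' : s.gcd q = r.gcd q := by
      rw [Nat.gcd_comm]; exact (Finset.mem_filter.1 hs).2
    exact H₁ N hN1 q r s hq hqN hr hs'
  have hinvφ : 1 / ((q / g).totient : ℝ) ≤ 32 * W * (h / q) := by
    have h1 := div_totient_le hqg0.ne'
    rw [Nat.cast_div hgq hg0'.ne'] at h1
    calc 1 / ((q / g).totient : ℝ) = (q / g : ℝ) / (q / g).totient * (g / q) := by field_simp
      _ ≤ (32 * divisorWeight (q / g)) * (g / q) := by gcongr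
      _ ≤ _ := by
          gcongr
          exact divisorWeight_mono (by omega) (Nat.div_dvd_of_dvd hgq)
  have hbound : |sumClass F q r N| ≤ C₁ * ((N : ℝ) ^ (1 - δ) / q) + |T| * (1 / (q / g).totient) := by
    rw [mul_one_div, ← sub_le_iff_le_add, ← mul_le_mul_iff_right₀ hφ]
    calc _ = |((q / g).totient : ℝ) * sumClass F q r N| - |T| := by
          rw [abs_mul, abs_of_pos hφ]; field_simp
      _ ≤ _ := (abs_sub_abs_le_abs_sub _ _).trans havg
  calc |sumClass F q r N| ≤ C₁ * (N * 1 * (1 / q)) + C₂ * (N * Λ) * W * (32 * W * (h / q)) := by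
        refine hbound.trans ?_
        have h1 : (N : ℝ) ^ (1 - δ) ≤ N := by
          calc (N : ℝ) ^ (1 - δ) ≤ (N : ℝ) ^ (1 : ℝ) :=
                Real.rpow_le_rpow_of_exponent_le hN1 (by linarith)
            _ = N := Real.rpow_one _
        have h2 : C₁ * ((N : ℝ) ^ (1 - δ) / q) ≤ C₁ * (N * 1 * (1 / q)) := by
          rw [mul_one, mul_one_div]; gcongr
        have h3 := mul_le_mul hTle hinvφ (by positivity) (by positivity)
        linarith
    _ ≤ C₁ * (N * Λ * (W ^ 2 / q)) + C₂ * (N * Λ) * W * (32 * W * (h / q)) := by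
        gcongr
        exact one_le_pow₀ hW1
    _ = _ := by ring

/-- The strict inequality `A < α` absorbs the shift `c` once `N` is large, as `(N+c)^A ≤ N^α`. For
bounded `N` the modulus is bounded too and a constant suffices; the factors `1 + N` keep the right
side usable at `N = 0`. -/
theorem Equidistributed.abs_sumClass_le_of_le_add_rpow {F : ℕ → ℝ} {α : ℝ}
    (hF : Equidistributed F α) {m : ℕ} (hcore : SmallOnMultiples F m) {h : ℕ} (hh : 1 ≤ h)
    {A : ℝ} (hA : 0 < A) (hAα : A < α) (c : ℕ) :
    ∃ C : ℝ, 0 ≤ C ∧ ∀ N q r : ℕ, 1 ≤ q → r.gcd q ∣ h → (q : ℝ) ≤ ((N + c : ℕ) : ℝ) ^ A →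
      |sumClass F q r N| ≤
        C * ((1 + N) * (1 + Real.log (1 + N)) ^ m * (divisorWeight q ^ 2 / q)) := by
  obtain ⟨C, hC, H⟩ := hF.abs_sumClass_le hcore hh
  have hev := (tendsto_rpow_atTop (sub_pos.2 hAα)).eventually_ge_atTop ((1 + (c : ℝ)) ^ A)
  obtain ⟨x₀, hx₀⟩ := Filter.eventually_atTop.1 hev
  set N₀ := max 1 ⌈x₀⌉₊ with hN₀
  set K := ∑ n ∈ Icc 1 N₀, |F n| with hK
  have hK0 : 0 ≤ K := Finset.sum_nonneg fun _ _ => abs_nonneg _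
  refine ⟨C + K * ((N₀ + c : ℕ) : ℝ) ^ A, by positivity, fun N q r hq hr hqN => ?_⟩
  have hq0 : (0 : ℝ) < q := by exact_mod_cast hq
  have hW1 : 1 ≤ divisorWeight q := one_le_divisorWeight (by omega)
  have hL : 0 ≤ Real.log (1 + N) := Real.log_nonneg (by linarith [Nat.cast_nonneg (α := ℝ) N])
  rcases le_total N₀ N with hN | hN
  · have hN1 : 1 ≤ N := (le_max_left _ _).trans hN
    have hN1' : (1 : ℝ) ≤ N := by exact_mod_cast hN1
    have hNx : x₀ ≤ N := (Nat.le_ceil x₀).trans (by exact_mod_cast (le_max_right _ _).trans hN)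
    have hqα : (q : ℝ) ≤ (N : ℝ) ^ α := by
      refine hqN.trans ?_
      calc ((N + c : ℕ) : ℝ) ^ A ≤ ((1 + (c : ℝ)) * N) ^ A := by
            gcongr
            push_cast
            nlinarith [Nat.cast_nonneg (α := ℝ) c]
        _ = (1 + (c : ℝ)) ^ A * (N : ℝ) ^ A := Real.mul_rpow (by positivity) (by positivity)
        _ ≤ (N : ℝ) ^ (α - A) * (N : ℝ) ^ A := by gcongr; exact hx₀ N hNx
        _ = _ := by rw [← Real.rpow_add (by linarith)]; ring_nf
    have hlog : Real.log N ≤ Real.log (1 + N) := Real.log_le_log (by linarith) (by linarith)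
    have hlogN := Real.log_nonneg hN1'
    refine (H N q r hN1 hq hr hqα).trans ?_
    gcongr
    · exact le_add_of_nonneg_right (by positivity)
    · linarith
  · calc |sumClass F q r N| ≤ K := by
          refine (Finset.abs_sum_le_sum_abs _ _).trans ?_
          refine Finset.sum_le_sum_of_subset_of_nonneg ?_ fun _ _ _ => abs_nonneg _
          rw [Nat.floor_natCast]
          exact (Finset.filter_subset _ _).trans (Finset.Icc_subset_Icc_right hN)
      _ = K * q * (1 * 1 * (1 / q)) := by field_simp
      _ ≤ K * ((N₀ + c : ℕ) : ℝ) ^ A *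
          ((1 + N) * (1 + Real.log (1 + N)) ^ m * (divisorWeight q ^ 2 / q)) := by
          gcongr
          · refine hqN.trans ?_
            gcongr
          · linarith [Nat.cast_nonneg (α := ℝ) N]
          · exact one_le_pow₀ (by linarith)
          · exact one_le_pow₀ hW1
      _ ≤ _ := by
          gcongr
          exact le_add_of_nonneg_left hC

theorem exists_divisorWeight_sq_le : ∃ C : ℝ, 0 ≤ C ∧ ∀ q : ℕ,
    divisorWeight q ^ 2 ≤ C * ∑ e ∈ q.divisors, (e : ℝ) ^ (-(1 / 4) : ℝ) := by
  have hs : Summable (fun n : ℕ => (n : ℝ) ^ (-(5 / 4) : ℝ)) :=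
    Real.summable_nat_rpow.2 (by norm_num)
  refine ⟨∑' n : ℕ, (n : ℝ) ^ (-(5 / 4) : ℝ), tsum_nonneg fun _ => by positivity, fun q => ?_⟩
  have hsq : ∀ e ∈ q.divisors, ∀ s : ℝ, ((e : ℝ) ^ s) ^ 2 = (e : ℝ) ^ (2 * s) := by
    intro e he s
    rw [mul_comm, Real.rpow_mul (by positivity)]
    norm_cast
  -- Cauchy–Schwarz with `3/4 = 5/8 + 1/8`: the squared first factor `e^(-5/4)` is summable over all
  -- `e`, and the second leaves a single divisor sum.
  calc divisorWeight q ^ 2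
      = (∑ e ∈ q.divisors, (e : ℝ) ^ (-(5 / 8) : ℝ) * (e : ℝ) ^ (-(1 / 8) : ℝ)) ^ 2 := by
        unfold divisorWeight
        congr 1
        refine Finset.sum_congr rfl fun e he => ?_
        have : (0 : ℝ) < e := by exact_mod_cast Nat.pos_of_mem_divisors he
        rw [← Real.rpow_add this]; norm_num
    _ ≤ (∑ e ∈ q.divisors, ((e : ℝ) ^ (-(5 / 8) : ℝ)) ^ 2) *
        ∑ e ∈ q.divisors, ((e : ℝ) ^ (-(1 / 8) : ℝ)) ^ 2 := Finset.sum_mul_sq_le_sq_mul_sq _ _ _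
    _ = (∑ e ∈ q.divisors, (e : ℝ) ^ (-(5 / 4) : ℝ)) *
        ∑ e ∈ q.divisors, (e : ℝ) ^ (-(1 / 4) : ℝ) := by
        congr 1 <;> refine Finset.sum_congr rfl fun e he => ?_ <;> rw [hsq e he] <;> norm_num
    _ ≤ _ := by
        gcongr
        exact hs.sum_le_tsum _ fun _ _ => by positivity

/-- The squared weight is bounded on average: restricting to multiples of `e` gains `dk j e / e`, so
the sum over `e` converges and no power of the logarithm is lost. -/
theorem exists_sum_dk_mul_divisorWeight_sq_le (j : ℕ) : ∃ C : ℝ, 0 ≤ C ∧ ∀ Q : ℕ, 1 ≤ Q →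
    ∑ q ∈ Icc 1 Q, (dk j q : ℝ) * (divisorWeight q ^ 2 / q) ≤ C * (1 + Real.log Q) ^ j := by
  obtain ⟨C₁, hC₁, H₁⟩ := exists_divisorWeight_sq_le
  obtain ⟨C₂, hC₂, H₂⟩ := exists_dk_le_rpow j (η := 1 / 8) (by norm_num)
  have hs : Summable (fun n : ℕ => (n : ℝ) ^ (-(9 / 8) : ℝ)) :=
    Real.summable_nat_rpow.2 (by norm_num)
  have hs0 : 0 ≤ ∑' n : ℕ, (n : ℝ) ^ (-(9 / 8) : ℝ) := tsum_nonneg fun _ => by positivity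
  refine ⟨C₁ * (C₂ * ∑' n : ℕ, (n : ℝ) ^ (-(9 / 8) : ℝ)), by positivity, fun Q hQ => ?_⟩
  have hQ1 : (1 : ℝ) ≤ Q := by exact_mod_cast hQ
  have hL : 0 ≤ Real.log Q := Real.log_nonneg hQ1
  calc _ ≤ ∑ q ∈ Icc 1 Q, (dk j q : ℝ) *
        ((C₁ * ∑ e ∈ q.divisors, (e : ℝ) ^ (-(1 / 4) : ℝ)) / q) := by
        gcongr with q
        exact H₁ q
    _ = C₁ * ∑ q ∈ Icc 1 Q, ∑ e ∈ q.divisors, (e : ℝ) ^ (-(1 / 4) : ℝ) * ((dk j q : ℝ) / q) := by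
        rw [Finset.mul_sum]
        refine Finset.sum_congr rfl fun q _ => ?_
        rw [← Finset.sum_mul]; ring
    _ = C₁ * ∑ e ∈ Icc 1 Q, (e : ℝ) ^ (-(1 / 4) : ℝ) *
        ∑ q ∈ Icc 1 Q with e ∣ q, (dk j q : ℝ) / q := by
        rw [sum_Icc_sum_divisors_filter Q
          (fun e q => (e : ℝ) ^ (-(1 / 4) : ℝ) * ((dk j q : ℝ) / q))]
        simp only [Finset.mul_sum]
    _ ≤ C₁ * ∑ e ∈ Icc 1 Q, C₂ * (e : ℝ) ^ (-(9 / 8) : ℝ) * (1 + Real.log Q) ^ j := by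
        refine mul_le_mul_of_nonneg_left (Finset.sum_le_sum fun e he => ?_) hC₁
        have he1 : 1 ≤ e := (mem_Icc.1 he).1
        have he0 : (0 : ℝ) < e := by exact_mod_cast he1
        have h1 := sum_dk_div_filter_dvd_le j hQ1 he1
        rw [Nat.floor_natCast] at h1
        calc _ ≤ (e : ℝ) ^ (-(1 / 4) : ℝ) * ((dk j e : ℝ) / e * (1 + Real.log Q) ^ j) := by gcongr
          _ ≤ (e : ℝ) ^ (-(1 / 4) : ℝ) * ((C₂ * (e : ℝ) ^ (1 / 8 : ℝ)) / e *
              (1 + Real.log Q) ^ j) := by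
              gcongr
              exact H₂ e (by omega)
          _ = C₂ * ((e : ℝ) ^ (-(1 / 4) : ℝ) * (e : ℝ) ^ (1 / 8 : ℝ) * (e : ℝ) ^ (-1 : ℝ)) *
              (1 + Real.log Q) ^ j := by rw [Real.rpow_neg_one]; ring
          _ = _ := by rw [← Real.rpow_add he0, ← Real.rpow_add he0]; norm_num
    _ = C₁ * (C₂ * ∑ e ∈ Icc 1 Q, (e : ℝ) ^ (-(9 / 8) : ℝ)) * (1 + Real.log Q) ^ j := by
        rw [← Finset.sum_mul, ← Finset.mul_sum]; ring
    _ ≤ _ := by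
        gcongr
        exact hs.sum_le_tsum _ fun _ _ => by positivity

/-! ### Correlations of a partial divisor function with a small equidistributed function. -/

theorem sum_Ioc_modEq_shift (F : ℕ → ℝ) (q r b : ℕ) {M N : ℕ} (hMN : M ≤ N) :
    ∑ n ∈ Ioc M N with n + b ≡ r [MOD q], F (n + b) =
      sumClass F q r ((N + b : ℕ) : ℝ) - sumClass F q r ((M + b : ℕ) : ℝ) := by
  have hIoc : ∀ K : ℕ, Icc 1 K = Ioc 0 K := fun K => by ext; simp [Nat.succ_le_iff]
  rw [sumClass, sumClass, Nat.floor_natCast, Nat.floor_natCast, Finset.sum_filter,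
    Finset.sum_filter, Finset.sum_filter, hIoc, hIoc,
    ← Finset.sum_Ioc_consecutive _ (Nat.zero_le (M + b)) (Nat.add_le_add_right hMN b),
    add_sub_cancel_left, ← Finset.map_add_right_Ioc, Finset.sum_map]
  rfl

/-- The natural number `a * (q - 1)` represents the class of `-a` modulo `q`. -/
theorem dvd_add_iff_modEq {q n a b : ℕ} (hq : 1 ≤ q) :
    q ∣ n + a ↔ n + b ≡ b + a * (q - 1) [MOD q] := by
  rw [Nat.modEq_iff_dvd, ← Int.natCast_dvd_natCast]
  push_cast [Nat.cast_sub hq]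
  have h : (b : ℤ) + a * (q - 1) - (n + b) = a * q - (n + a) := by ring
  rw [h, dvd_sub_right (dvd_mul_left _ _)]

/-- The key estimate for correlations of a partial divisor function with an equidistributed `F`
that is small on average over multiples. -/
theorem exists_abs_sum_partialDk_mul_le (j : ℕ) {m h a b : ℕ} (hh : 1 ≤ h)
    (hab : (a = h ∧ b = 0) ∨ (a = 0 ∧ b = h)) {A α : ℝ} (hA : 0 < A) (hAα : A < α) {F : ℕ → ℝ}
    (hF : Equidistributed F α) (hcore : SmallOnMultiples F m) :
    ∃ C : ℝ, 0 ≤ C ∧ ∀ N : ℕ, |∑ n ∈ Icc 1 N, (partialDk (j + 1) (n + a) A : ℝ) * F (n + b)| ≤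
      C * ((1 + (N + h : ℕ)) * (1 + Real.log (1 + (N + h : ℕ))) ^ (m + j)) := by
  -- The shift `h + 1` is needed at the lower endpoint `M = ⌈q^(1/A)⌉ - a - 1`, where only `q^(1/A)
  -- ≤ M + a + 1 ≤ M + h + 1` is known.
  obtain ⟨C₁, hC₁, H₁⟩ := hF.abs_sumClass_le_of_le_add_rpow hcore hh hA hAα (h + 1)
  obtain ⟨C₂, hC₂, H₂⟩ := exists_sum_dk_mul_divisorWeight_sq_le j
  refine ⟨2 * C₁ * C₂, by positivity, fun N => ?_⟩
  have ha : a ≤ h := by omega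
  have hb : b ≤ h := by omega
  set X : ℝ := 1 + (N + h : ℕ) with hX
  have hX1 : 1 ≤ X := by rw [hX]; linarith [Nat.cast_nonneg (α := ℝ) (N + h)]
  have hLX : 0 ≤ Real.log X := Real.log_nonneg hX1
  have hinner : ∀ q ∈ Icc 1 (N + a),
      |∑ n ∈ Icc 1 N with q ∣ n + a ∧ (q : ℝ) ≤ ((n + a : ℕ) : ℝ) ^ A, F (n + b)| ≤
        2 * (C₁ * (X * (1 + Real.log X) ^ m * (divisorWeight q ^ 2 / q))) := by
    intro q hq
    have hq1 : 1 ≤ q := (mem_Icc.1 hq).1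
    have hq0 : (0 : ℝ) < q := by exact_mod_cast hq1
    set r := b + a * (q - 1) with hr
    -- The class is that of `-h` or `h`: `r + h = h q` when `a = h`, and `r = h` when `b = h`.
    have hrh : r.gcd q ∣ h := by
      have h1 : r.gcd q ∣ q := Nat.gcd_dvd_right _ _
      have h2 : r.gcd q ∣ r := Nat.gcd_dvd_left _ _
      rcases hab with ⟨h3, h4⟩ | ⟨h3, h4⟩
      · have h5 : h * q = r + h := by
          rw [hr, h3, h4]
          obtain ⟨p, rfl⟩ := Nat.exists_eq_add_of_le' hq1
          simp; ring
        have h6 : r.gcd q ∣ r + h := h5 ▸ h1.mul_left h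
        exact (Nat.dvd_add_right h2).1 h6
      · rw [hr, h3, h4] at h2 ⊢
        simpa using h2
    set T := ⌈(q : ℝ) ^ (1 / A)⌉₊ with hT
    set M := T - a - 1 with hM
    have hset : {n ∈ Icc 1 N | q ∣ n + a ∧ (q : ℝ) ≤ ((n + a : ℕ) : ℝ) ^ A} =
        {n ∈ Ioc M N | n + b ≡ r [MOD q]} := by
      ext n
      simp only [mem_filter, mem_Icc, mem_Ioc]
      rw [le_rpow_iff_rpow_one_div_le hA hq0.le (by positivity), ← Nat.ceil_le, ← hT,
        dvd_add_iff_modEq (b := b) hq1, ← hr]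
      constructor
      · rintro ⟨⟨h1, h2⟩, h3, h4⟩
        exact ⟨⟨by omega, h2⟩, h3⟩
      · rintro ⟨⟨h1, h2⟩, h3⟩
        exact ⟨⟨by omega, h2⟩, h3, by omega⟩
    rw [hset]
    rcases le_total N M with hMN | hMN
    · rw [Finset.Ioc_eq_empty_of_le hMN]
      simp only [Finset.filter_empty, Finset.sum_empty, abs_zero]
      positivity
    · rw [sum_Ioc_modEq_shift F q r b hMN]
      have hone : ∀ K, M ≤ K → K ≤ N → |sumClass F q r ((K + b : ℕ) : ℝ)| ≤
          C₁ * (X * (1 + Real.log X) ^ m * (divisorWeight q ^ 2 / q)) := by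
        intro K hMK hKN
        have hqK : (q : ℝ) ≤ ((K + b + (h + 1) : ℕ) : ℝ) ^ A := by
          rw [le_rpow_iff_rpow_one_div_le hA hq0.le (by positivity), ← Nat.ceil_le, ← hT]
          omega
        refine (H₁ (K + b) q r hq1 hrh hqK).trans ?_
        have hKX : (1 : ℝ) + (K + b : ℕ) ≤ X := by
          rw [hX]
          have : K + b ≤ N + h := by omega
          gcongr
        have hK1 : (1 : ℝ) ≤ 1 + (K + b : ℕ) := by linarith [Nat.cast_nonneg (α := ℝ) (K + b)]
        have := Real.log_nonneg hK1
        gcongr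
      refine (abs_sub _ _).trans ?_
      linarith [hone N hMN le_rfl, hone M le_rfl hMN]
  rcases Nat.eq_zero_or_pos N with hN | hN
  · rw [hN]
    simp only [zero_lt_one, Finset.Icc_eq_empty_of_lt, Finset.sum_empty, abs_zero]
    positivity
  rw [sum_mul_partialDk j N a A (fun n => F (n + b))]
  calc _ ≤ ∑ q ∈ Icc 1 (N + a), 2 * (C₁ * (X * (1 + Real.log X) ^ m)) *
        ((dk j q : ℝ) * (divisorWeight q ^ 2 / q)) := by
        refine (Finset.abs_sum_le_sum_abs _ _).trans (Finset.sum_le_sum fun q hq => ?_)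
        rw [abs_mul, abs_of_nonneg (by positivity)]
        calc _ ≤ (dk j q : ℝ) * (2 * (C₁ * (X * (1 + Real.log X) ^ m *
              (divisorWeight q ^ 2 / q)))) := by
              gcongr
              exact hinner q hq
          _ = _ := by ring
    _ ≤ 2 * (C₁ * (X * (1 + Real.log X) ^ m)) * (C₂ * (1 + Real.log X) ^ j) := by
        rw [← Finset.mul_sum]
        gcongr
        refine (H₂ (N + a) (by omega)).trans ?_
        have h1 : (1 : ℝ) ≤ (N + a : ℕ) := by exact_mod_cast (by omega : 1 ≤ N + a)
        have h2 := Real.log_nonneg h1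
        have h3 : ((N + a : ℕ) : ℝ) ≤ X := by
          have : ((N + a : ℕ) : ℝ) ≤ (N + h : ℕ) := by gcongr
          rw [hX]; linarith
        gcongr
    _ = _ := by rw [pow_add]; ring

/-- The partial divisor function, normalised so that its average order does not depend on `B`. -/
noncomputable def normPartialDk (l n : ℕ) (B : ℝ) : ℝ := B ^ (1 - (l : ℤ)) * partialDk l n B

/-- The normalisation cancels the factor `B^(j+1)` in the main term, which becomes common to `B` and
`B'`; only the errors, one logarithm smaller, survive. -/
theorem smallOnMultiples_sub (j : ℕ) {B B' : ℝ} (hB : 0 < B) (hB1 : B ≤ 1) (hB' : 0 < B')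
    (hB1' : B' ≤ 1) :
    SmallOnMultiples (fun n => normPartialDk (j + 2) n B - normPartialDk (j + 2) n B') j := by
  obtain ⟨c, hc⟩ := exists_sum_partialDk_filter_dvd_asymp j
  have key : ∀ B : ℝ, 0 < B → B ≤ 1 → ∃ C : ℝ, 0 ≤ C ∧ ∀ N D : ℕ, 1 ≤ N → 1 ≤ D →
      |∑ n ∈ Icc 1 N with D ∣ n, normPartialDk (j + 2) n B - c D * N * Real.log N ^ (j + 1)| ≤
        C * (N * (D : ℝ) ^ (-(3 / 4) : ℝ) * (1 + Real.log N) ^ j) := by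
    intro B hB hB1
    obtain ⟨C, hC, H⟩ := hc B hB hB1
    refine ⟨B ^ (1 - ((j + 2 : ℕ) : ℤ)) * C, by positivity, fun N D hN hD => ?_⟩
    have hpow : B ^ (1 - ((j + 2 : ℕ) : ℤ)) * B ^ (j + 1) = 1 := by
      rw [← zpow_natCast B (j + 1), ← zpow_add₀ hB.ne']
      push_cast
      rw [show (1 : ℤ) - (j + 2) + (j + 1) = 0 by ring, zpow_zero]
    have h1 : ∑ n ∈ Icc 1 N with D ∣ n, normPartialDk (j + 2) n B
        - c D * N * Real.log N ^ (j + 1) = B ^ (1 - ((j + 2 : ℕ) : ℤ)) *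
        (∑ n ∈ Icc 1 N with D ∣ n, (partialDk (j + 2) n B : ℝ) -
          B ^ (j + 1) * (c D * N * Real.log N ^ (j + 1))) := by
      rw [mul_sub, ← mul_assoc, hpow, one_mul, Finset.mul_sum]
      rfl
    rw [h1, abs_mul, abs_of_nonneg (by positivity), mul_assoc _ C]
    exact mul_le_mul_of_nonneg_left (H N D hN hD) (by positivity)
  obtain ⟨C, hC, H⟩ := key B hB hB1
  obtain ⟨C', hC', H'⟩ := key B' hB' hB1'
  refine ⟨C + C', by positivity, fun N D hN hD => ?_⟩
  rw [Finset.sum_sub_distrib, add_mul]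
  have h2 := H' N D hN hD
  rw [abs_sub_comm] at h2
  exact (abs_sub_le _ _ _).trans (add_le_add (H N D hN hD) h2)

theorem Equidistributed.normPartialDk_sub {l : ℕ} {B B' α : ℝ}
    (h : Equidistributed (fun n => (partialDk l n B : ℝ)) α)
    (h' : Equidistributed (fun n => (partialDk l n B' : ℝ)) α) :
    Equidistributed (fun n => normPartialDk l n B - normPartialDk l n B') α :=
  (h.const_mul _).sub (h'.const_mul _)

/-- The correlation of a normalised partial divisor function with the difference of two others. -/
theorem exists_abs_sum_normPartialDk_mul_sub_le {k l h a b : ℕ} (hk : 1 ≤ k) (hl : 2 ≤ l)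
    (hh : 1 ≤ h) (hab : (a = h ∧ b = 0) ∨ (a = 0 ∧ b = h)) {A α B B' : ℝ} (hA : 0 < A)
    (hAα : A < α) (hB : 0 < B) (hB1 : B ≤ 1) (hB' : 0 < B') (hB1' : B' ≤ 1)
    (hF : Equidistributed (fun n => (partialDk l n B : ℝ)) α)
    (hF' : Equidistributed (fun n => (partialDk l n B' : ℝ)) α) :
    ∃ C : ℝ, 0 ≤ C ∧ ∀ N : ℕ, |∑ n ∈ Icc 1 N, normPartialDk k (n + a) A *
      (normPartialDk l (n + b) B - normPartialDk l (n + b) B')| ≤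
      C * ((1 + (N + h : ℕ)) * (1 + Real.log (1 + (N + h : ℕ))) ^ (k + l - 3)) := by
  obtain ⟨j, rfl⟩ := Nat.exists_eq_add_of_le' hk
  obtain ⟨i, rfl⟩ := Nat.exists_eq_add_of_le' hl
  obtain ⟨C, hC, H⟩ := exists_abs_sum_partialDk_mul_le j hh hab hA hAα
    (hF.normPartialDk_sub hF') (smallOnMultiples_sub i hB hB1 hB' hB1')
  refine ⟨A ^ (1 - ((j + 1 : ℕ) : ℤ)) * C, by positivity, fun N => ?_⟩
  have hidx : j + 1 + (i + 2) - 3 = i + j := by omega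
  simp only [normPartialDk] at H ⊢
  simp only [mul_assoc (A ^ (1 - ((j + 1 : ℕ) : ℤ)))]
  rw [hidx, ← Finset.mul_sum, abs_mul, abs_of_nonneg (by positivity)]
  gcongr
  exact H N

theorem normPartialDk_one_left {n : ℕ} (hn : n ≠ 0) {B : ℝ} (hB : 0 ≤ B) :
    normPartialDk 1 n B = 1 := by
  simp [normPartialDk, partialDk_one_left hn hB]

theorem isBigO_of_floor_bound {f : ℕ → ℝ} {h m : ℕ} {C : ℝ} (hC : 0 ≤ C)
    (H : ∀ N : ℕ, |f N| ≤ C * ((1 + (N + h : ℕ)) * (1 + Real.log (1 + (N + h : ℕ))) ^ m)) :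
    (fun x : ℝ => f ⌊x⌋₊) =O[Filter.atTop] fun x : ℝ => x * Real.log x ^ m := by
  -- For large `x`, `1 + ⌊x⌋ + h ≤ 2x ≤ x²`, so its logarithm is at most `2 log x`, and `1 ≤ log x`
  -- accounts for the third `log x`.
  refine Asymptotics.IsBigO.of_bound (C * (2 * 3 ^ m)) ?_
  filter_upwards [Filter.eventually_ge_atTop ((1 : ℝ) + h), Filter.eventually_ge_atTop (Real.exp 1)]
    with x hx hxe
  have hh : (0 : ℝ) ≤ h := Nat.cast_nonneg h
  have hx1 : 1 ≤ x := by linarith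
  have hL : 1 ≤ Real.log x := by
    rw [Real.le_log_iff_exp_le (by linarith)]; exact hxe
  have hx2 : 2 ≤ x := by
    have := Real.add_one_le_exp (1 : ℝ)
    linarith
  have h1 : (1 : ℝ) + (⌊x⌋₊ + h : ℕ) ≤ 2 * x := by
    push_cast
    linarith [Nat.floor_le (by linarith : 0 ≤ x)]
  have h0 : (1 : ℝ) ≤ 1 + (⌊x⌋₊ + h : ℕ) := by
    linarith [Nat.cast_nonneg (α := ℝ) (⌊x⌋₊ + h)]
  have hlog0 := Real.log_nonneg h0
  have hlog : 1 + Real.log (1 + (⌊x⌋₊ + h : ℕ)) ≤ 3 * Real.log x := by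
    have h2 : Real.log (1 + (⌊x⌋₊ + h : ℕ)) ≤ Real.log (x * x) :=
      Real.log_le_log (by linarith) (h1.trans (by gcongr))
    rw [Real.log_mul (by linarith) (by linarith)] at h2
    linarith
  rw [Real.norm_eq_abs, Real.norm_of_nonneg (by positivity)]
  calc _ ≤ C * ((1 + (⌊x⌋₊ + h : ℕ)) * (1 + Real.log (1 + (⌊x⌋₊ + h : ℕ))) ^ m) := H _
    _ ≤ C * (2 * x * (3 * Real.log x) ^ m) := by gcongr
    _ = _ := by rw [mul_pow]; ring

end DivisorCorrelation


/-! ### The telescoping argument. -/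

open DivisorCorrelation in
theorem mainTheorem6 (h k l : ℕ) (hh : 1 ≤ h) (hk : 1 ≤ k) (hl : 1 ≤ l)
    (θ : ℕ → ℝ)
    (hθl : ∀ g : ℕ, 1 ≤ g → DivisorCorrelation.IsExponentOfDistribution g l (θ l))
    (hθk : ∀ g : ℕ, 1 ≤ g → DivisorCorrelation.IsExponentOfDistribution g k (θ k))
    (hθk' : ∀ g : ℕ, 1 ≤ g → DivisorCorrelation.IsExponentOfDistribution g (k - 1) (θ (k - 1)))
    (A B : ℝ) (hA : 0 < A) (hAθ : A < θ l)
    (hB : 0 < B) (hBθ : B < min (θ k) (A * θ (k - 1))) :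
    (fun x : ℝ => ∑ n ∈ Finset.Icc 1 ⌊x⌋₊,
        (DivisorCorrelation.partialDk k (n + h) A : ℝ) *
          ((DivisorCorrelation.dk l n : ℝ) -
            B ^ (1 - (l : ℤ)) * (DivisorCorrelation.partialDk l n B : ℝ)))
      =O[Filter.atTop]
        (fun x : ℝ => x * Real.log x ^ ((k : ℤ) + (l : ℤ) - 3)) := by
  have hθl1 := (hθl 1 le_rfl).2.1
  have hθk1 := (hθk 1 le_rfl).2.1
  have hA1 : A < 1 := by linarith
  have hB1 : B < 1 := (hBθ.trans_le (min_le_left _ _)).trans_le hθk1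
  -- For `l = 1` both terms of the difference equal 1 and the sum vanishes, which also covers a
  -- negative exponent of the logarithm. Otherwise `k + l ≥ 3`.
  rcases hl.eq_or_lt with rfl | hl2
  · refine (Asymptotics.isBigO_zero _ _).congr_left fun x => ?_
    symm
    refine Finset.sum_eq_zero fun n hn => ?_
    have hn0 : n ≠ 0 := by have := (Finset.mem_Icc.1 hn).1; omega
    simp [dk_one hn0, partialDk_one_left hn0 hB.le]
  obtain ⟨j, rfl⟩ := Nat.exists_eq_add_of_le' hk
  obtain ⟨i, rfl⟩ := Nat.exists_eq_add_of_le' hl2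
  rw [Nat.add_sub_cancel] at hθk' hBθ
  obtain ⟨α, hα1, hα2⟩ := exists_between hAθ
  obtain ⟨β, hβ1, hβ2⟩ := exists_between hBθ
  have hβk := hβ2.trans_le (min_le_left _ _)
  have hβk' := hβ2.trans_le (min_le_right _ _)
  -- The auxiliary exponent is small enough for trivial counting to give level `α` to `d_l(·,ε)` and
  -- `β` to `d_k(·,ε)`. It also leaves room for a `γ > ε` with `γ + B < 1`, a level shared by
  -- `d_l(·,ε)` and `d_l(·,B)`.
  obtain ⟨ε, hε0, hε⟩ := exists_between
    (show (0 : ℝ) < min B (min (1 - α) (min (1 - β) (1 - B))) by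
      refine lt_min hB (lt_min ?_ (lt_min ?_ ?_)) <;> linarith)
  simp only [lt_min_iff] at hε
  obtain ⟨hεB, hεα, hεβ, hεB1⟩ := hε
  obtain ⟨γ, hγ1, hγ2⟩ := exists_between (show ε < 1 - B by linarith)
  have e1 : Equidistributed (fun n => (partialDk (i + 2) n 1 : ℝ)) α := by
    have := equidistributed_dk hθl hα2
    simpa only [partialDk_one (by omega : 1 ≤ i + 2)] using this
  have e2 : Equidistributed (fun n => (partialDk (i + 2) n ε : ℝ)) α :=
    equidistributed_partialDk_of_add_lt_one (i + 1) hε0 (by linarith)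
  have e3 : Equidistributed (fun n => (partialDk (i + 2) n ε : ℝ)) γ :=
    equidistributed_partialDk_of_add_lt_one (i + 1) hε0 (by linarith)
  have e4 : Equidistributed (fun n => (partialDk (i + 2) n B : ℝ)) γ :=
    equidistributed_partialDk_of_add_lt_one (i + 1) hB (by linarith)
  have e5 : Equidistributed (fun n => (partialDk (j + 1) n A : ℝ)) β :=
    equidistributed_partialDk hA hA1 (by linarith) hθk hθk' hβk hβk'
  have e6 : Equidistributed (fun n => (partialDk (j + 1) n ε : ℝ)) β :=
    equidistributed_partialDk_of_add_lt_one j hε0 (by linarith)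
  set f : ℝ → ℕ → ℝ := fun t n => normPartialDk (j + 1) n t with hf
  set g : ℝ → ℕ → ℝ := fun t n => normPartialDk (i + 2) n t with hg
  have b1 : ∃ C : ℝ, 0 ≤ C ∧ ∀ N : ℕ, |∑ n ∈ Icc 1 N, f A (n + h) * (g 1 n - g ε n)| ≤
      C * ((1 + (N + h : ℕ)) * (1 + Real.log (1 + (N + h : ℕ))) ^ (j + 1 + (i + 2) - 3)) :=
    exists_abs_sum_normPartialDk_mul_sub_le (a := h) (b := 0) (by omega) (by omega) hh
      (Or.inl ⟨rfl, rfl⟩) hA hα1 one_pos le_rfl hε0 (by linarith) e1 e2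
  have b3 : ∃ C : ℝ, 0 ≤ C ∧ ∀ N : ℕ, |∑ n ∈ Icc 1 N, f ε (n + h) * (g ε n - g B n)| ≤
      C * ((1 + (N + h : ℕ)) * (1 + Real.log (1 + (N + h : ℕ))) ^ (j + 1 + (i + 2) - 3)) :=
    exists_abs_sum_normPartialDk_mul_sub_le (a := h) (b := 0) (by omega) (by omega) hh
      (Or.inl ⟨rfl, rfl⟩) hε0 hγ1 hε0 (by linarith) hB hB1.le e3 e4
  have b24 : ∀ t : ℝ, 0 < t → t < β → ∃ C : ℝ, 0 ≤ C ∧ ∀ N : ℕ,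
      |∑ n ∈ Icc 1 N, g t n * (f A (n + h) - f ε (n + h))| ≤
      C * ((1 + (N + h : ℕ)) * (1 + Real.log (1 + (N + h : ℕ))) ^ (j + 1 + (i + 2) - 3)) := by
    intro t ht htβ
    -- For `k = 1` the normalised function is identically 1 on positive integers, so the difference
    -- vanishes.
    rcases Nat.eq_zero_or_pos j with rfl | hj
    · refine ⟨0, le_rfl, fun N => ?_⟩
      rw [Finset.sum_eq_zero fun n _ => ?_]
      · simp
      · have hn : n + h ≠ 0 := by omega
        simp only [hf, zero_add, normPartialDk_one_left hn hA.le,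
          normPartialDk_one_left hn hε0.le, sub_self, mul_zero]
    · have := exists_abs_sum_normPartialDk_mul_sub_le (k := i + 2) (l := j + 1) (a := 0) (b := h)
        (by omega) (by omega) hh (Or.inr ⟨rfl, rfl⟩) ht htβ hA hA1.le hε0 (by linarith) e5 e6
      rwa [add_comm (i + 2) (j + 1)] at this
  obtain ⟨C₁, hC₁, H₁⟩ := b1
  obtain ⟨C₂, hC₂, H₂⟩ := b24 ε hε0 (by linarith)
  obtain ⟨C₃, hC₃, H₃⟩ := b3
  obtain ⟨C₄, hC₄, H₄⟩ := b24 B hB hβ1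
  have hmain : ∀ N : ℕ, |∑ n ∈ Icc 1 N, f A (n + h) * (g 1 n - g B n)| ≤
      (C₁ + C₂ + C₃ + C₄) * ((1 + (N + h : ℕ)) *
        (1 + Real.log (1 + (N + h : ℕ))) ^ (j + 1 + (i + 2) - 3)) := by
    intro N
    -- Passing through `ε` first in `g`, then in `f`, and back: in each term the opened factor has
    -- an exponent below the level of the difference beside it.
    have hsplit : ∑ n ∈ Icc 1 N, f A (n + h) * (g 1 n - g B n) =
        ∑ n ∈ Icc 1 N, f A (n + h) * (g 1 n - g ε n) +
        ∑ n ∈ Icc 1 N, g ε n * (f A (n + h) - f ε (n + h)) +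
        ∑ n ∈ Icc 1 N, f ε (n + h) * (g ε n - g B n) -
        ∑ n ∈ Icc 1 N, g B n * (f A (n + h) - f ε (n + h)) := by
      rw [← Finset.sum_add_distrib, ← Finset.sum_add_distrib, ← Finset.sum_sub_distrib]
      exact Finset.sum_congr rfl fun n _ => by ring
    rw [hsplit, add_mul, add_mul, add_mul]
    refine (abs_sub _ _).trans (add_le_add ?_ (H₄ N))
    refine (abs_add_le _ _).trans (add_le_add ?_ (H₃ N))
    exact (abs_add_le _ _).trans (add_le_add (H₁ N) (H₂ N))
  have hO := isBigO_of_floor_bound (f := fun N => ∑ n ∈ Icc 1 N, f A (n + h) * (g 1 n - g B n))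
    (by positivity) hmain
  have hcoef : A ^ (1 - ((j + 1 : ℕ) : ℤ)) ≠ 0 := zpow_ne_zero _ hA.ne'
  refine ((hO.const_mul_left (A ^ (1 - ((j + 1 : ℕ) : ℤ)))⁻¹).congr (fun x => ?_) fun x => ?_)
  · rw [Finset.mul_sum]
    refine Finset.sum_congr rfl fun n _ => ?_
    simp only [hf, hg, normPartialDk, partialDk_one (by omega : 1 ≤ i + 2), one_zpow, one_mul]
    rw [mul_assoc, inv_mul_cancel_left₀ hcoef]
  -- The truncated exponent `k + l - 3` agrees with the integer one because `k ≥ 1` and `l ≥ 2`.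
  · rw [← zpow_natCast]
    congr 2
    push_cast [show 3 ≤ j + 1 + (i + 2) by omega]
    ring
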